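/- Let $K$ be a field, let $G$ be a simple graph on $[n]=\{1,\dots,n\}$, let $S=K[x_1,\dots,x_n,y_1,\dots,y_n]$ with the standard grading, and let $J_G=(x_iy_j-x_jy_i : \{i,j\}\in E(G),\ i<j)\subset S$ be the binomial edge ideal of $G$. Write $\beta_{i,j}=\beta^S_{i,j}(S/J_G)=\dim_K\operatorname{Tor}_i^S(S/J_G,K)_j$ for the graded Betti numbers of $S/J_G$, and $\operatorname{reg}(S/J_G)=\max\{j-i : \beta_{i,j}\neq 0\}$ for its Castelnuovo–Mumford regularity. A nonzero Betti number $\beta_{i,i+r}$ is called extremal if $\beta_{k,k+l}=0$ for all pairs $(k,l)\neq(i,r)$ with $k\ge i$ and $l\ge r$. Let $h_{S/J_G}(t)\in\mathbb{Z}[t]$ be the $h$-polynomial of $S/J_G$, that is, the unique polynomial with $h_{S/J_G}(1)\neq 0$ and $\sum_{k\ge 0}\dim_K\big((S/J_G)_k\big)\,t^k=h_{S/J_G}(t)/(1-t)^d$, where $d=\dim(S/J_G)$ is the Krull dimension. Theorem. If $G$ is connected and $S/J_G$ admits a unique extremal Betti number (that is, $\beta_{i,i+r}$ is extremal for exactly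 one pair $(i,r)$), then $$\operatorname{reg}(S/J_G)\le \deg h_{S/J_G}(t).$$ -/

import Mathlib

open scoped Polynomial PowerSeries

noncomputable section

namespace BinomialEdge

section GradedModules

variable (σ : Type*) {K M : Type*} [Fintype σ] [LinearOrder σ] [Field K] [AddCommGroup M]
  [Module (MvPolynomial σ K) M] [Module K M] [IsScalarTower K (MvPolynomial σ K) M]

variable (K M) in
/-- The differential of the Koszul complex `K_•(X; M)` of all the variables of
`S = K[X_v : v ∈ σ]` with coefficients in an `S`-module `M`. A chain `∑ₛ c(s) e_s`, where
`e_s = e_{v₁} ∧ ⋯ ∧ e_{vᵢ}` for `s = {v₁ < ⋯ < vᵢ}`, is the function `s ↦ c(s)`, and the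
differential is the one determined by `d(e_s) = ∑ₖ (-1)^(k-1) X_{vₖ} e_{s \ {vₖ}}`. -/
def koszulD : (Finset σ → M) →ₗ[K] (Finset σ → M) where
  toFun c t := ∑ v ∈ tᶜ, (-1 : ℤ) ^ (t.filter (· < v)).card •
    ((MvPolynomial.X v : MvPolynomial σ K) • c (insert v t))
  map_add' c c' := by
    funext t
    simp [smul_add, Finset.sum_add_distrib]
  map_smul' a c := by
    funext t
    simp only [Pi.smul_apply, RingHom.id_apply, Finset.smul_sum]
    refine Finset.sum_congr rfl fun v _ => ?_
    rw [smul_comm a, smul_algebra_smul_comm a]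

/-- The Koszul differential squares to zero. -/
theorem koszulD_comp_koszulD : koszulD σ K M ∘ₗ koszulD σ K M = 0 := by
  refine LinearMap.ext fun c => funext fun t => ?_
  simp only [koszulD, LinearMap.comp_apply, LinearMap.coe_mk, AddHom.coe_mk, Finset.smul_sum,
    LinearMap.zero_apply, Pi.zero_apply]
  rw [Finset.sum_sigma']
  have hlt : ∀ v u : σ, v ∉ t → u ∉ t → v < u →
      (-1 : ℤ) ^ (t.filter (· < v)).card * (-1) ^ ((insert v t).filter (· < u)).card
        + (-1 : ℤ) ^ (t.filter (· < u)).card * (-1) ^ ((insert u t).filter (· < v)).card = 0 := by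
    intro v u hv hu h
    rw [Finset.filter_insert, Finset.filter_insert, if_pos h, if_neg h.not_gt,
      Finset.card_insert_of_notMem (by simp [hv])]
    ring
  refine Finset.sum_involution (fun p _ => ⟨p.2, p.1⟩) ?_ ?_ ?_ ?_
  · rintro ⟨v, u⟩ h
    simp only [Finset.mem_sigma, Finset.mem_compl, Finset.mem_insert, not_or] at h
    obtain ⟨hv, huv, hu⟩ := h
    rw [Finset.insert_comm v u t]
    simp only [smul_comm (MvPolynomial.X v : MvPolynomial σ K) ((-1 : ℤ) ^ _) (_ : M),
      smul_comm (MvPolynomial.X u : MvPolynomial σ K) ((-1 : ℤ) ^ _) (_ : M), smul_smul]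
    rw [mul_comm (MvPolynomial.X u : MvPolynomial σ K) (MvPolynomial.X v), ← add_smul]
    rcases lt_or_gt_of_ne huv with h | h
    · rw [add_comm, hlt u v hu hv h, zero_smul]
    · rw [hlt v u hv hu h, zero_smul]
  · rintro ⟨v, u⟩ h _ heq
    simp only [Finset.mem_sigma, Finset.mem_compl, Finset.mem_insert, not_or] at h
    exact h.2.1 (congrArg Sigma.fst heq)
  · rintro ⟨v, u⟩ h
    simp only [Finset.mem_sigma, Finset.mem_compl, Finset.mem_insert, not_or] at h ⊢
    exact ⟨h.2.2, fun e => h.2.1 e.symm, h.1⟩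
  · rintro ⟨v, u⟩ _
    rfl


/-- The Koszul chains of homological degree `i` and internal degree `j`, where `ℳ k` is the
homogeneous component of degree `k` of `M`; the basis element `e_s` has homological degree and
internal degree `|s|`. -/
def koszulChains (ℳ : ℕ → Submodule K M) (i j : ℕ) : Submodule K (Finset σ → M) :=
  Submodule.pi Set.univ fun s => if s.card = i ∧ i ≤ j then ℳ (j - i) else ⊥

/-- The cycles of homological degree `i` and internal degree `j`. -/
def koszulCycles (ℳ : ℕ → Submodule K M) (i j : ℕ) : Submodule K (Finset σ → M) :=
  koszulChains σ ℳ i j ⊓ LinearMap.ker (koszulD σ K M)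

/-- The boundaries of homological degree `i` and internal degree `j`. -/
def koszulBoundaries (ℳ : ℕ → Submodule K M) (i j : ℕ) : Submodule K (Finset σ → M) :=
  (koszulChains σ ℳ (i + 1) j).map (koszulD σ K M)

/-- The graded Betti number `β_{i,j}^S(M) = dim_K Tor_i^S(M, K)_j`, where `Tor` is the homology of
`M ⊗ P` for the graded free resolution `P` of `K` given by the Koszul complex on the variables. -/
def gradedBetti (ℳ : ℕ → Submodule K M) (i j : ℕ) : ℕ :=
  Module.finrank K
    (koszulCycles σ ℳ i j ⧸ (koszulBoundaries σ ℳ i j).submoduleOf (koszulCycles σ ℳ i j))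

/-- The Castelnuovo–Mumford regularity `max {j - i : β_{i,j}(M) ≠ 0}` of a nonzero module
`M = ⊕_{k ≥ 0} M_k`. (The Betti numbers `β_{i,j}` with `j < i` of such a module vanish.) -/
def regularity (ℳ : ℕ → Submodule K M) : ℕ∞ :=
  ⨆ (i : ℕ) (r : ℕ) (_ : gradedBetti σ ℳ i (i + r) ≠ 0), (r : ℕ∞)

/-- `β_{i,i+r}(M)` is an extremal Betti number: it is nonzero, and `β_{k,k+l}(M) = 0` for all
`(k, l) ≠ (i, r)` with `k ≥ i` and `l ≥ r`. -/
def IsExtremalBetti (ℳ : ℕ → Submodule K M) (i r : ℕ) : Prop :=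
  gradedBetti σ ℳ i (i + r) ≠ 0 ∧
    ∀ k l, i ≤ k → r ≤ l → (k, l) ≠ (i, r) → gradedBetti σ ℳ k (k + l) = 0

/-- `M` admits a unique extremal Betti number. -/
def HasUniqueExtremalBetti (ℳ : ℕ → Submodule K M) : Prop :=
  ∃! p : ℕ × ℕ, IsExtremalBetti σ ℳ p.1 p.2

end GradedModules

section HPolynomial

variable (σ : Type*) {K M : Type*} [Field K] [AddCommGroup M]
  [Module (MvPolynomial σ K) M] [Module K M]

/-- The Hilbert series `∑ₖ (dim_K M_k) t^k`. -/
def hilbertSeries (ℳ : ℕ → Submodule K M) : ℤ⟦X⟧ :=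
  PowerSeries.mk fun k => (Module.finrank K (ℳ k) : ℤ)

/-- `h` satisfies the defining property of the `h`-polynomial of `M`: `h(1) ≠ 0` and
`Hilb_M(t) = h(t) / (1 - t)^d`, where `d` is the Krull dimension of `M`. -/
def IsHPolynomial (ℳ : ℕ → Submodule K M) (h : ℤ[X]) : Prop :=
  h.eval 1 ≠ 0 ∧ ∃ d : ℕ, Module.supportDim (MvPolynomial σ K) M = d ∧
    hilbertSeries ℳ * (1 - PowerSeries.X) ^ d = (h : ℤ⟦X⟧)

/-- The defining property determines the `h`-polynomial. -/
theorem IsHPolynomial.unique {ℳ : ℕ → Submodule K M} {h h' : ℤ[X]}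
    (H : IsHPolynomial σ ℳ h) (H' : IsHPolynomial σ ℳ h') : h = h' := by
  obtain ⟨-, d, hd, e⟩ := H
  obtain ⟨-, d', hd', e'⟩ := H'
  obtain rfl : d = d' := by exact_mod_cast hd.symm.trans hd'
  exact Polynomial.coe_injective ℤ (e.symm.trans e')

open Classical in
/-- The `h`-polynomial of `M`. -/
def hPolynomial (ℳ : ℕ → Submodule K M) : ℤ[X] :=
  if H : ∃ h, IsHPolynomial σ ℳ h then H.choose else 0

end HPolynomial

/-- The homogeneous component of degree `k` of the standard graded algebra `S / I`. -/
def quotientPiece {σ K : Type*} [Field K] (I : Ideal (MvPolynomial σ K)) (k : ℕ) :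
    Submodule K (MvPolynomial σ K ⧸ I) :=
  (MvPolynomial.homogeneousSubmodule σ K k).map (Ideal.Quotient.mkₐ K I).toLinearMap

/-- The index set of the variables `x₁ < ⋯ < xₙ < y₁ < ⋯ < yₙ`. -/
abbrev Vars (n : ℕ) : Type := Fin n ⊕ₗ Fin n

/-- The variable `xᵢ` of `S = K[x₁, …, xₙ, y₁, …, yₙ]`. -/
def xVar (K : Type*) [Field K] {n : ℕ} (i : Fin n) : MvPolynomial (Vars n) K :=
  MvPolynomial.X (Sum.inlₗ i)

/-- The variable `yᵢ` of `S = K[x₁, …, xₙ, y₁, …, yₙ]`. -/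
def yVar (K : Type*) [Field K] {n : ℕ} (i : Fin n) : MvPolynomial (Vars n) K :=
  MvPolynomial.X (Sum.inrₗ i)

/-- The binomial edge ideal `J_G = (xᵢ yⱼ - xⱼ yᵢ : {i, j} ∈ E(G), i < j)`. -/
def binomialEdgeIdeal (K : Type*) [Field K] {n : ℕ} (G : SimpleGraph (Fin n)) :
    Ideal (MvPolynomial (Vars n) K) :=
  Ideal.span {f | ∃ i j : Fin n, G.Adj i j ∧ i < j ∧ f = xVar K i * yVar K j - xVar K j * yVar K i}

end BinomialEdge

end

noncomputable section

set_option linter.unusedSectionVars false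

namespace BinomialEdge

/-! ### The Koszul complex as functions on subsets, and its null-homotopies. -/

section Koszul

variable {σ K M : Type*} [Fintype σ] [LinearOrder σ] [Field K] [AddCommGroup M]
  [Module (MvPolynomial σ K) M] [Module K M] [IsScalarTower K (MvPolynomial σ K) M]

/-! Let `N` be the number of variables. A nonzero Betti number lies weakly below some extremal one,
because only finitely many positions of the Betti table are nonzero. If the extremal one is unique,
at `(p, r)`, then `p` is the last nonzero column and `r` the last nonzero row, so `r` is the
regularity.

The Euler characteristic of the Koszul complex gives `Hilb(t) (1 - t)^N = Q(t)`, where the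
coefficients of `Q` are alternating sums of Betti numbers. In degree `p + r` only `β_{p,p+r}`
contributes, so nothing cancels and `deg Q = p + r`. Writing `Q = (1 - t)^c h` with `h(1) ≠ 0` gives
`deg h = r + (p - c)`, and it remains to see that `c ≤ p`.

This is depth ≤ dimension, in two halves. The Koszul homology vanishes above degree `p`, which
forces `N - p ≤ dim` (`le_supportDim_of_koszulExactAt`). The pole order `N - c` of the Hilbert
series equals the dimension (`supportDim_quotient_eq`), by Noether normalization and a comparison of
growth rates. The corner and the numerator are found in `exists_corner` and `exists_numerator`. The
binomial edge ideal enters through being generated by forms and lying in the ideal of the variables.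
-/

theorem koszulD_apply (c : Finset σ → M) (t : Finset σ) :
    koszulD σ K M c t = ∑ v ∈ tᶜ, (-1 : ℤ) ^ (t.filter (· < v)).card •
      ((MvPolynomial.X v : MvPolynomial σ K) • c (insert v t)) := rfl

theorem koszulD_koszulD (c : Finset σ → M) : koszulD σ K M (koszulD σ K M c) = 0 :=
  LinearMap.congr_fun (koszulD_comp_koszulD σ) c

theorem koszulD_smul (f : MvPolynomial σ K) (c : Finset σ → M) :
    koszulD σ K M (f • c) = f • koszulD σ K M c := by
  funext t
  simp only [koszulD_apply, Pi.smul_apply, Finset.smul_sum]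
  refine Finset.sum_congr rfl fun v _ => ?_
  rw [smul_comm f, smul_comm f]

theorem koszulD_map {M' : Type*} [AddCommGroup M'] [Module (MvPolynomial σ K) M'] [Module K M']
    [IsScalarTower K (MvPolynomial σ K) M'] (φ : M →ₗ[MvPolynomial σ K] M') (c : Finset σ → M) :
    koszulD σ K M' (fun s => φ (c s)) = fun s => φ (koszulD σ K M c s) := by
  funext t
  simp only [koszulD_apply, map_sum, map_zsmul, map_smul]

/-- The part of homological degree `i` of a Koszul chain. -/
def koszulPart (i : ℕ) (c : Finset σ → M) : Finset σ → M :=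
  fun s => if s.card = i then c s else 0

/-- Allows a preimage under the differential to be cut down to the correct homological degree. -/
theorem koszulD_koszulPart (i : ℕ) (c : Finset σ → M) :
    koszulD σ K M (koszulPart (i + 1) c) = koszulPart i (koszulD σ K M c) := by
  funext t
  simp only [koszulD_apply, koszulPart]
  split_ifs with h
  · refine Finset.sum_congr rfl fun v hv => ?_
    rw [Finset.card_insert_of_notMem (by simpa using hv), if_pos (by rw [h])]
  · refine Finset.sum_eq_zero fun v hv => ?_
    rw [Finset.card_insert_of_notMem (by simpa using hv), if_neg (by omega), smul_zero, smul_zero]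

/-- Left multiplication of Koszul chains by `e_v`. -/
def koszulWedge (v : σ) (c : Finset σ → M) : Finset σ → M :=
  fun s => if v ∈ s then (-1 : ℤ) ^ (s.filter (· < v)).card • c (s.erase v) else 0

/-- Multiplication by `X_v` is null-homotopic on the Koszul complex. -/
theorem koszulD_koszulWedge (v : σ) (c : Finset σ → M) :
    koszulD σ K M (koszulWedge v c) + koszulWedge v (koszulD σ K M c) =
      (MvPolynomial.X v : MvPolynomial σ K) • c := by
  have hsq : ∀ n : ℕ, (-1 : ℤ) ^ n * (-1) ^ n = 1 := fun n => by
    rw [← mul_pow]; simp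
  funext t
  simp only [Pi.add_apply, Pi.smul_apply, koszulWedge, koszulD_apply]
  by_cases hv : v ∈ t
  -- For `v ∈ t`, the summand at `v` of the second term yields `X_v • c t`. The remaining summands
  -- cancel in pairs, since exchanging `e_u` and `e_v` changes the sign.
  · have hc : (t.erase v)ᶜ = insert v tᶜ := by
      ext u; by_cases h : u = v <;> simp [h]
    rw [if_pos hv, hc, Finset.sum_insert (by simpa using hv), smul_add, ← add_assoc,
      Finset.insert_erase hv]
    have hf : (t.erase v).filter (· < v) = t.filter (· < v) := by
      ext u; simp only [Finset.mem_filter, Finset.mem_erase]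
      exact ⟨fun h => ⟨h.1.2, h.2⟩, fun h => ⟨⟨h.2.ne, h.1⟩, h.2⟩⟩
    rw [hf, smul_smul, hsq, one_smul, add_right_comm, Finset.smul_sum, ← Finset.sum_add_distrib,
      add_eq_right]
    refine Finset.sum_eq_zero fun u hu => ?_
    have hu : u ∉ t := by simpa using hu
    have huv : u ≠ v := fun h => hu (h ▸ hv)
    rw [if_pos (Finset.mem_insert_of_mem hv), Finset.erase_insert_of_ne huv,
      smul_comm (MvPolynomial.X u : MvPolynomial σ K) ((-1 : ℤ) ^ _) (_ : M), smul_smul, smul_smul,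
      ← add_smul]
    convert zero_smul ℤ _
    rcases lt_or_gt_of_ne huv with h | h
    · rw [Finset.filter_insert, if_pos h, Finset.card_insert_of_notMem (by simp [hu])]
      have : (t.erase v).filter (· < u) = t.filter (· < u) := by
        rw [Finset.filter_erase, Finset.erase_eq_of_notMem (by simp [h.not_gt])]
      rw [this]; ring
    · rw [Finset.filter_insert, if_neg h.not_gt, Finset.filter_erase]
      have : (t.filter (· < u)).card = ((t.filter (· < u)).erase v).card + 1 :=
        (Finset.card_erase_add_one (by simp [hv, h])).symm
      rw [this]; ring
  · rw [if_neg hv, add_zero, Finset.sum_eq_single v]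
    · rw [if_pos (Finset.mem_insert_self v t), Finset.erase_insert hv, Finset.filter_insert,
        if_neg (lt_irrefl v), smul_comm (MvPolynomial.X v : MvPolynomial σ K) ((-1 : ℤ) ^ _) (_ : M),
        smul_smul, hsq, one_smul]
    · intro u hu huv
      rw [if_neg (by simp [hv, Ne.symm huv]), smul_zero, smul_zero]
    · intro h; exact absurd (by simpa using hv) h

variable (σ K M) in
/-- The Koszul complex `K_•(X; M)` is exact in homological degree `i`. -/
def KoszulExactAt (i : ℕ) : Prop :=
  ∀ c : Finset σ → M, (∀ s, s.card ≠ i → c s = 0) → koszulD σ K M c = 0 →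
    ∃ b : Finset σ → M, (∀ s, s.card ≠ i + 1 → b s = 0) ∧ koszulD σ K M b = c

end Koszul

/-! ### Depth is at most dimension, with depth read off from Koszul homology. -/

section Depth

open scoped Pointwise

variable {σ K : Type*} [Fintype σ] [LinearOrder σ] [Field K]

/-- This is the segment `H_{i+1}(M) → H_{i+1}(M/fM) → H_i(M)` of the long exact sequence, done by
hand: lift the cycle to `l`, write `d l = f a`, solve `a = d b`, and correct `l` to the cycle `l - f
b`. -/
theorem KoszulExactAt.quotSMulTop {M : Type*} [AddCommGroup M]
    [Module (MvPolynomial σ K) M] [Module K M] [IsScalarTower K (MvPolynomial σ K) M]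
    {f : MvPolynomial σ K} (hf : IsSMulRegular M f) {i : ℕ}
    (h : KoszulExactAt σ K M i) (h' : KoszulExactAt σ K M (i + 1)) :
    KoszulExactAt σ K (QuotSMulTop f M) (i + 1) := by
  intro c hc hdc
  let π : M →ₗ[MvPolynomial σ K] QuotSMulTop f M := Submodule.mkQ _
  have hker : ∀ m, π m = 0 → ∃ a, f • a = m := fun m hm => by
    have := (Submodule.Quotient.mk_eq_zero _).1 hm
    obtain ⟨a, -, ha⟩ := (Submodule.mem_smul_pointwise_iff_exists _ _ _).1 this
    exact ⟨a, ha⟩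
  have hlift : ∀ s, ∃ m, π m = c s ∧ (s.card ≠ i + 1 → m = 0) := fun s => by
    by_cases hs : s.card = i + 1
    · obtain ⟨m, hm⟩ := Submodule.mkQ_surjective _ (c s)
      exact ⟨m, hm, fun h => absurd hs h⟩
    · exact ⟨0, by rw [map_zero, hc s hs], fun _ => rfl⟩
  choose l hl hl0 using hlift
  have hπl : (fun s => π (l s)) = c := funext hl
  have hdl : ∀ s, π (koszulD σ K M l s) = 0 := fun s => by
    have := congrFun (koszulD_map π l) s
    rw [hπl, hdc] at this
    exact this.symm
  choose a ha using fun s => hker _ (hdl s)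
  have ha' : f • a = koszulD σ K M l := funext ha
  have hlpart : koszulPart (i + 1) l = l := by
    funext s; unfold koszulPart; split_ifs with h
    · rfl
    · exact (hl0 s h).symm
  have ha0 : ∀ s, s.card ≠ i → a s = 0 := fun s hs => by
    apply hf
    change f • a s = f • 0
    rw [ha, smul_zero, ← hlpart, koszulD_koszulPart, koszulPart, if_neg hs]
  have hda : koszulD σ K M a = 0 := by
    funext s
    apply hf
    change (f • koszulD σ K M a) s = f • 0
    rw [← koszulD_smul, ha', koszulD_koszulD, smul_zero, Pi.zero_apply]
  obtain ⟨b, hb0, hb⟩ := h a ha0 hda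
  obtain ⟨e, he0, he⟩ := h' (l - f • b)
    (fun s hs => by simp [hl0 s hs, hb0 s hs])
    (by rw [map_sub, koszulD_smul, hb, ha', sub_self])
  refine ⟨fun s => π (e s), fun s hs => by simp [he0 s hs], ?_⟩
  rw [koszulD_map, he, ← hπl]
  funext s
  have : π (f • b s) = 0 := (Submodule.Quotient.mk_eq_zero _).2
    (Submodule.smul_mem_pointwise_smul _ _ _ trivial)
  simp [this]

/-- The depth of `M` with respect to the variables, as measured by the vanishing of Koszul
homology, is at most the dimension of `M`. -/
theorem le_supportDim_of_koszulExactAt (k : ℕ) : ∀ {M : Type*} [AddCommGroup M]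
    [Module (MvPolynomial σ K) M] [Module K M] [IsScalarTower K (MvPolynomial σ K) M]
    [Module.Finite (MvPolynomial σ K) M] (p : ℕ), p + k = Fintype.card σ →
    (∀ i, p < i → KoszulExactAt σ K M i) →
    Ideal.span (Set.range (MvPolynomial.X : σ → MvPolynomial σ K)) •
      (⊤ : Submodule (MvPolynomial σ K) M) ≠ ⊤ →
    (k : WithBot ℕ∞) ≤ Module.supportDim (MvPolynomial σ K) M := by
  induction k with
  | zero =>
    intro M _ _ _ _ _ p hp hex htop
    have : Nontrivial M := by
      by_contra h
      rw [not_nontrivial_iff_subsingleton] at h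
      exact htop (Subsingleton.elim _ _)
    have h := (Module.supportDim_ne_bot_iff_nontrivial (R := MvPolynomial σ K) (M := M)).2 this
    obtain ⟨d, hd⟩ := WithBot.ne_bot_iff_exists.1 h
    rw [← hd]
    exact_mod_cast zero_le
  | succ k ih =>
    intro M _ _ _ _ _ p hp hex htop
    set m : Ideal (MvPolynomial σ K) := Ideal.span (Set.range MvPolynomial.X) with hm
    -- The top Koszul homology is the socle: an `x` killed by all variables gives the cycle `x
    -- e_univ`, and there are no nonzero chains above it to bound it.
    have hsoc : ∀ x : M, (∀ v, (MvPolynomial.X v : MvPolynomial σ K) • x = 0) → x = 0 := by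
      intro x hx
      obtain ⟨b, hb0, hb⟩ := hex (Fintype.card σ) (by omega)
        (fun s => if s = Finset.univ then x else 0)
        (fun s hs => if_neg fun h => hs (by rw [h, Finset.card_univ])) (by
          funext t
          refine Finset.sum_eq_zero fun v _ => ?_
          dsimp only
          split_ifs
          · rw [hx, smul_zero]
          · rw [smul_zero, smul_zero])
      have hb' : b = 0 := funext fun s => hb0 s (by have := Finset.card_le_univ s; omega)
      have := congrFun hb Finset.univ
      rw [hb', map_zero, if_pos rfl] at this
      exact this.symm
    -- Otherwise prime avoidance puts `m` inside an associated prime, the annihilator of some `x`.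
    -- Then `x` is in the socle, hence zero, and its annihilator is not proper.
    obtain ⟨f, hfm, hf⟩ : ∃ f ∈ m, IsSMulRegular M f := by
      by_contra! hcon
      have hsub : (m : Set (MvPolynomial σ K)) ⊆
          ⋃ P ∈ associatedPrimes (MvPolynomial σ K) M, P := by
        rw [biUnion_associatedPrimes_eq_compl_regular]
        exact hcon
      obtain ⟨P, hP, hmP⟩ := (Ideal.subset_union_prime_finite
        (associatedPrimes.finite (MvPolynomial σ K) M) (f := id) 0 0
        (fun P hP _ _ => hP.1)).1 hsub
      obtain ⟨hprime, x, hx⟩ := isAssociatedPrime_iff.1 hP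
      have hx0 : x = 0 := hsoc x fun v => by
        have : (MvPolynomial.X v : MvPolynomial σ K) ∈ P := hmP (Ideal.subset_span ⟨v, rfl⟩)
        rwa [hx, Submodule.mem_colon_singleton, Submodule.mem_bot] at this
      refine hprime.ne_top ((Ideal.eq_top_iff_one P).2 ?_)
      rw [hx, Submodule.mem_colon_singleton, hx0, smul_zero]
      exact Submodule.zero_mem _
    have hdim : Module.supportDim (MvPolynomial σ K) (QuotSMulTop f M) + 1 ≤
        Module.supportDim (MvPolynomial σ K) M :=
      Module.supportDim_quotSMulTop_succ_le_of_notMem_minimalPrimes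
        fun _ => hf.notMem_of_mem_minimalPrimes
    refine le_trans ?_ hdim
    push_cast
    gcongr
    -- Passing to `M/fM` lowers the dimension by at least one and the range of exactness by exactly
    -- one. The condition `mM ≠ M` survives because `f ∈ m`.
    refine ih (p + 1) (by omega) ?_ ?_
    · rintro (_ | i) hi
      · omega
      · exact (hex i (by omega)).quotSMulTop hf (hex (i + 1) (by omega))
    · intro h
      apply htop
      have hle : f • (⊤ : Submodule (MvPolynomial σ K) M) ≤ m • ⊤ := by
        rw [← Submodule.ideal_span_singleton_smul]
        exact Submodule.smul_mono_left ((Ideal.span_singleton_le_iff_mem _).2 hfm)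
      have h2 := congrArg (Submodule.comap (Submodule.mkQ (f • (⊤ : Submodule _ M)))) h
      rw [Submodule.comap_top, ← Submodule.range_mkQ, ← Submodule.map_top, ← Submodule.map_smul'',
        Submodule.comap_map_mkQ] at h2
      rwa [sup_eq_right.2 hle] at h2

end Depth

/-! ### Graded Koszul homology: exactness, vanishing in high degree, and the Euler characteristic.
-/

section Graded

variable {σ K M : Type*} [Fintype σ] [LinearOrder σ] [Field K] [AddCommGroup M]
  [Module (MvPolynomial σ K) M] [Module K M] [IsScalarTower K (MvPolynomial σ K) M]

variable (σ) in
/-- The maps `π q` are the projections of a grading `M = ⨁ ℳ q` over the polynomial ring. -/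
structure IsGradedProjection (ℳ : ℕ → Submodule K M) (π : ℕ → M →ₗ[K] M) : Prop where
  mem : ∀ q m, π q m ∈ ℳ q
  apply_of_mem : ∀ q, ∀ m ∈ ℳ q, π q m = m
  apply_of_ne : ∀ q q', ∀ m ∈ ℳ q, q' ≠ q → π q' m = 0
  sum_apply : ∀ m, ∃ n, ∀ n' ≥ n, ∑ q ∈ Finset.range n', π q m = m
  X_smul : ∀ q (v : σ) m, π (q + 1) ((MvPolynomial.X v : MvPolynomial σ K) • m) =
    (MvPolynomial.X v : MvPolynomial σ K) • π q m
  zero_X_smul : ∀ (v : σ) m, π 0 ((MvPolynomial.X v : MvPolynomial σ K) • m) = 0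

variable {ℳ : ℕ → Submodule K M} {π : ℕ → M →ₗ[K] M}

theorem IsGradedProjection.X_smul_mem (hπ : IsGradedProjection σ ℳ π) {q : ℕ} (v : σ) {m : M}
    (hm : m ∈ ℳ q) : (MvPolynomial.X v : MvPolynomial σ K) • m ∈ ℳ (q + 1) := by
  rw [← hπ.apply_of_mem q m hm, ← hπ.X_smul]
  exact hπ.mem _ _

theorem IsGradedProjection.koszulD_succ (hπ : IsGradedProjection σ ℳ π) (q : ℕ)
    (c : Finset σ → M) :
    koszulD σ K M (fun s => π q (c s)) = fun s => π (q + 1) (koszulD σ K M c s) := by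
  funext t
  simp only [koszulD_apply, map_sum, map_zsmul, hπ.X_smul]

theorem IsGradedProjection.koszulD_mem (hπ : IsGradedProjection σ ℳ π) {q : ℕ}
    {c : Finset σ → M} (hc : ∀ s, c s ∈ ℳ q) (s : Finset σ) : koszulD σ K M c s ∈ ℳ (q + 1) :=
  Submodule.sum_mem _ fun v _ => zsmul_mem (hπ.X_smul_mem v (hc _)) _

/-- Writing the internal degree as `i + q` removes the truncated subtraction: `q` is the degree of
the coefficients. -/
theorem mem_koszulChains_add {i q : ℕ} {c : Finset σ → M} :
    c ∈ koszulChains σ ℳ i (i + q) ↔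
      (∀ s, c s ∈ ℳ q) ∧ ∀ s, s.card ≠ i → c s = 0 := by
  simp only [koszulChains, Submodule.mem_pi, Set.mem_univ, true_implies, Nat.le_add_right,
    and_true, Nat.add_sub_cancel_left]
  constructor
  · intro h
    refine ⟨fun s => ?_, fun s hs => ?_⟩
    · have := h s
      split_ifs at this
      · exact this
      · rw [(Submodule.mem_bot K).1 this]; exact zero_mem _
    · simpa [hs] using h s
  · rintro ⟨h, h'⟩ s
    split_ifs with hs
    · exact h s
    · exact h' s hs

theorem apply_eq_zero_of_mem_koszulChains {i j : ℕ} {c : Finset σ → M}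
    (hc : c ∈ koszulChains σ ℳ i j) {s : Finset σ} (hs : s.card ≠ i) : c s = 0 := by
  simpa [hs] using hc s trivial

theorem koszulChains_eq_bot_of_lt {i j : ℕ} (h : j < i) : koszulChains σ ℳ i j = ⊥ := by
  refine (Submodule.eq_bot_iff _).2 fun c hc => funext fun s => ?_
  simpa [h.not_ge] using hc s trivial

theorem koszulChains_eq_bot_of_card_lt {i j : ℕ} (h : Fintype.card σ < i) :
    koszulChains σ ℳ i j = ⊥ := by
  refine (Submodule.eq_bot_iff _).2 fun c hc => funext fun s => ?_
  exact apply_eq_zero_of_mem_koszulChains hc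
    fun hs => by have := Finset.card_le_univ s; omega

variable (σ ℳ) in
/-- The space of Koszul chains of bidegree `(i, j)` as a product. -/
def koszulChainsEquiv (i j : ℕ) : koszulChains σ ℳ i j ≃ₗ[K]
    ∀ s : Finset σ, (if s.card = i ∧ i ≤ j then ℳ (j - i) else ⊥ : Submodule K M) where
  toFun c s := ⟨c.1 s, c.2 s trivial⟩
  invFun g := ⟨fun s => g s, fun s _ => (g s).2⟩
  map_add' _ _ := rfl
  map_smul' _ _ := rfl
  left_inv _ := rfl
  right_inv _ := rfl

instance koszulChains_finite [∀ q, FiniteDimensional K (ℳ q)] (i j : ℕ) :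
    FiniteDimensional K (koszulChains σ ℳ i j) := by
  have (s : Finset σ) : FiniteDimensional K
      (if s.card = i ∧ i ≤ j then ℳ (j - i) else ⊥ : Submodule K M) := by
    by_cases h : s.card = i ∧ i ≤ j
    · rw [if_pos h]; infer_instance
    · rw [if_neg h]; infer_instance
  exact Module.Finite.equiv (koszulChainsEquiv σ ℳ i j).symm

theorem finrank_koszulChains [∀ q, FiniteDimensional K (ℳ q)] (i j : ℕ) :
    Module.finrank K (koszulChains σ ℳ i j) =
      if i ≤ j then (Fintype.card σ).choose i * Module.finrank K (ℳ (j - i)) else 0 := by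
  have (s : Finset σ) : FiniteDimensional K
      (if s.card = i ∧ i ≤ j then ℳ (j - i) else ⊥ : Submodule K M) := by
    by_cases h : s.card = i ∧ i ≤ j
    · rw [if_pos h]; infer_instance
    · rw [if_neg h]; infer_instance
  have h (s : Finset σ) : Module.finrank K
      (if s.card = i ∧ i ≤ j then ℳ (j - i) else ⊥ : Submodule K M) =
      if s.card = i ∧ i ≤ j then Module.finrank K (ℳ (j - i)) else 0 := by
    by_cases h : s.card = i ∧ i ≤ j
    · rw [if_pos h, if_pos h]
    · rw [if_neg h, if_neg h, finrank_bot]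
  rw [(koszulChainsEquiv σ ℳ i j).finrank_eq, Module.finrank_pi_fintype]
  simp only [h]
  split_ifs with hij
  · simp only [hij, and_true]
    rw [← Finset.sum_filter, Finset.sum_const, smul_eq_mul, ← Finset.card_univ,
      ← Finset.card_powersetCard]
    congr 2
    ext s; simp [Finset.mem_powersetCard]
  · simp [hij]

theorem IsGradedProjection.koszulBoundaries_le (hπ : IsGradedProjection σ ℳ π) (i j : ℕ) :
    koszulBoundaries σ ℳ i j ≤ koszulCycles σ ℳ i j := by
  rintro _ ⟨b, hb, rfl⟩
  refine ⟨?_, koszulD_koszulD b⟩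
  rcases lt_or_ge j (i + 1) with h | h
  · rw [SetLike.mem_coe, koszulChains_eq_bot_of_lt h, Submodule.mem_bot] at hb
    rw [hb, map_zero]
    exact zero_mem _
  · obtain ⟨q, rfl⟩ := Nat.exists_eq_add_of_le h
    obtain ⟨h1, h2⟩ := mem_koszulChains_add.1 hb
    rw [show i + 1 + q = i + (q + 1) by ring]
    refine mem_koszulChains_add.2 ⟨hπ.koszulD_mem h1, fun s hs => ?_⟩
    have : koszulPart (i + 1) b = b := by
      funext s; unfold koszulPart; split_ifs with h
      · rfl
      · exact (h2 s h).symm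
    rw [← this, koszulD_koszulPart, koszulPart, if_neg hs]

theorem IsGradedProjection.gradedBetti_add_finrank [∀ q, FiniteDimensional K (ℳ q)]
    (hπ : IsGradedProjection σ ℳ π) (i j : ℕ) :
    gradedBetti σ ℳ i j + Module.finrank K (koszulBoundaries σ ℳ i j) =
      Module.finrank K (koszulCycles σ ℳ i j) := by
  have : FiniteDimensional K (koszulCycles σ ℳ i j) :=
    Submodule.finiteDimensional_of_le inf_le_left
  rw [← Submodule.finrank_quotient_add_finrank
    ((koszulBoundaries σ ℳ i j).submoduleOf (koszulCycles σ ℳ i j)), gradedBetti,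
    (Submodule.submoduleOfEquivOfLe (hπ.koszulBoundaries_le i j)).finrank_eq]

theorem IsGradedProjection.gradedBetti_eq_zero_iff [∀ q, FiniteDimensional K (ℳ q)]
    (hπ : IsGradedProjection σ ℳ π) (i j : ℕ) :
    gradedBetti σ ℳ i j = 0 ↔ koszulCycles σ ℳ i j ≤ koszulBoundaries σ ℳ i j := by
  have : FiniteDimensional K (koszulCycles σ ℳ i j) :=
    Submodule.finiteDimensional_of_le inf_le_left
  have h := hπ.gradedBetti_add_finrank i j
  constructor
  · intro h0
    rw [h0, zero_add] at h
    exact (Submodule.eq_of_le_of_finrank_eq (hπ.koszulBoundaries_le i j) h).ge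
  · intro hle
    have := le_antisymm hle (hπ.koszulBoundaries_le i j)
    rw [this] at h
    omega

theorem gradedBetti_eq_zero_of_card_lt {i j : ℕ} (h : Fintype.card σ < i) :
    gradedBetti σ ℳ i j = 0 := by
  have : koszulCycles σ ℳ i j = ⊥ := by
    rw [koszulCycles, koszulChains_eq_bot_of_card_lt h, bot_inf_eq]
  have : Subsingleton (koszulCycles σ ℳ i j) := by rw [this]; infer_instance
  exact Module.finrank_zero_of_subsingleton

theorem gradedBetti_eq_zero_of_lt {i j : ℕ} (h : j < i) :
    gradedBetti σ ℳ i j = 0 := by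
  have : koszulCycles σ ℳ i j = ⊥ := by
    rw [koszulCycles, koszulChains_eq_bot_of_lt h, bot_inf_eq]
  have : Subsingleton (koszulCycles σ ℳ i j) := by rw [this]; infer_instance
  exact Module.finrank_zero_of_subsingleton

/-- Vanishing of the graded Betti numbers in homological degree `i` means exactness there. -/
theorem IsGradedProjection.koszulExactAt [∀ q, FiniteDimensional K (ℳ q)]
    (hπ : IsGradedProjection σ ℳ π) {i : ℕ} (h : ∀ q, gradedBetti σ ℳ i (i + q) = 0) :
    KoszulExactAt σ K M i := by
  intro c hc hdc
  have hq : ∀ q, ∃ b : Finset σ → M, (∀ s, s.card ≠ i + 1 → b s = 0) ∧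
      koszulD σ K M b = fun s => π q (c s) := by
    intro q
    have hmem : (fun s => π q (c s)) ∈ koszulCycles σ ℳ i (i + q) := by
      refine ⟨mem_koszulChains_add.2 ⟨fun s => hπ.mem _ _, fun s hs => ?_⟩, ?_⟩
      · simp [hc s hs]
      · rw [SetLike.mem_coe, LinearMap.mem_ker, hπ.koszulD_succ, hdc]
        simp only [Pi.zero_apply, map_zero]
        rfl
    obtain ⟨b, hb, hb'⟩ := (hπ.gradedBetti_eq_zero_iff i (i + q)).1 (h q) hmem
    exact ⟨b, fun s hs => apply_eq_zero_of_mem_koszulChains hb hs, hb'⟩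
  choose b hb hb' using hq
  -- A chain has finitely many coefficients, each with finitely many homogeneous components, so
  -- finitely many of the graded preimages suffice.
  choose n hn using fun s => hπ.sum_apply (c s)
  refine ⟨∑ q ∈ Finset.range (Finset.univ.sup n), b q, fun s hs => ?_, ?_⟩
  · rw [Finset.sum_apply]
    exact Finset.sum_eq_zero fun q _ => hb q s hs
  · rw [map_sum]
    funext s
    rw [Finset.sum_apply]
    simp only [hb']
    exact hn s _ (Finset.le_sup (Finset.mem_univ s))

/-- The Koszul cycles, as a module over the polynomial ring, generated in degrees at most `k`. -/
def koszulCyclesSpan (ℳ : ℕ → Submodule K M) (k : ℕ) :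
    Submodule (MvPolynomial σ K) (Finset σ → M) :=
  Submodule.span _ {c | koszulD σ K M c = 0 ∧ ∃ q ≤ k, ∀ s, c s ∈ ℳ q}

theorem koszulCyclesSpan_mono : Monotone (koszulCyclesSpan (σ := σ) ℳ) := fun _ _ h =>
  Submodule.span_mono fun _ hc => ⟨hc.1, let ⟨q, hq, hc⟩ := hc.2; ⟨q, hq.trans h, hc⟩⟩

/-- The generators have no component of degree above `k`. Any further component arises by
multiplying a cycle by a variable, and this gives a boundary because `X_v z = d (e_v ∧ z)` for a
cycle `z`. -/
theorem IsGradedProjection.exists_koszulD_eq_of_mem_span (hπ : IsGradedProjection σ ℳ π) {k : ℕ}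
    {w : Finset σ → M} (hw : w ∈ koszulCyclesSpan ℳ k) :
    koszulD σ K M w = 0 ∧ ∀ q, k ≤ q →
      (fun s => π (q + 1) (w s)) ∈
        (Submodule.pi Set.univ fun _ : Finset σ => ℳ q).map (koszulD σ K M) := by
  induction hw using Submodule.span_induction with
  | mem w hw =>
    obtain ⟨hdw, q, hq, hwq⟩ := hw
    refine ⟨hdw, fun q' hq' => ?_⟩
    convert Submodule.zero_mem _
    exact hπ.apply_of_ne q _ _ (hwq _) (by omega)
  | zero =>
    refine ⟨map_zero _, fun q _ => ?_⟩
    convert Submodule.zero_mem _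
    exact map_zero _
  | add x y _ _ hx hy =>
    refine ⟨by rw [map_add, hx.1, hy.1, add_zero], fun q hq => ?_⟩
    convert add_mem (hx.2 q hq) (hy.2 q hq) using 1
    funext s
    exact map_add _ _ _
  | smul f x _ hx =>
    induction f using MvPolynomial.induction_on with
    | C a =>
      have : (MvPolynomial.C a : MvPolynomial σ K) • x = a • x := algebraMap_smul _ a x
      rw [this]
      refine ⟨by rw [map_smul, hx.1, smul_zero], fun q hq => ?_⟩
      convert Submodule.smul_mem _ a (hx.2 q hq) using 1
      funext s
      exact map_smul _ _ _
    | add f g hf hg =>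
      rw [add_smul]
      refine ⟨by rw [map_add, hf.1, hg.1, add_zero], fun q hq => ?_⟩
      convert add_mem (hf.2 q hq) (hg.2 q hq) using 1
      funext s
      exact map_add _ _ _
    | mul_X f v hf =>
      rw [mul_comm, mul_smul]
      refine ⟨by rw [koszulD_smul, hf.1, smul_zero], fun q hq => ?_⟩
      have h1 := koszulD_koszulWedge (K := K) v (fun s => π q ((f • x) s))
      have h2 : koszulD σ K M (fun s => π q ((f • x) s)) = 0 := by
        rw [hπ.koszulD_succ, hf.1]
        simp only [Pi.zero_apply, map_zero]
        rfl
      have h3 : koszulWedge v (0 : Finset σ → M) = 0 := by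
        funext s; simp [koszulWedge]
      rw [h2, h3, add_zero] at h1
      refine ⟨_, fun s _ => ?_, h1.trans ?_⟩
      · unfold koszulWedge
        split_ifs
        · exact zsmul_mem (hπ.mem _ _) _
        · exact zero_mem _
      · funext s
        exact (hπ.X_smul q v _).symm

/-- The graded Betti numbers `β_{i,i+l}` of a Noetherian module vanish for large `l`. -/
theorem IsGradedProjection.exists_gradedBetti_eq_zero [IsNoetherian (MvPolynomial σ K) M]
    [∀ q, FiniteDimensional K (ℳ q)] (hπ : IsGradedProjection σ ℳ π) :
    ∃ e, ∀ i l, e < l → gradedBetti σ ℳ i (i + l) = 0 := by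
  -- Chains form a Noetherian module, so the submodules generated by cycles of coefficient degree at
  -- most `k` stabilize at some `e`. Cycles of higher degree then lie in the span for `e` and are
  -- boundaries.
  obtain ⟨e, he⟩ := monotone_stabilizes_iff_noetherian.2
    (inferInstance : IsNoetherian (MvPolynomial σ K) (Finset σ → M))
    ⟨koszulCyclesSpan ℳ, koszulCyclesSpan_mono⟩
  refine ⟨e, fun i l hl => (hπ.gradedBetti_eq_zero_iff _ _).2 fun z hz => ?_⟩
  obtain ⟨hz1, hz2⟩ := hz
  obtain ⟨hz1, hz3⟩ := mem_koszulChains_add.1 hz1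
  obtain ⟨q, rfl⟩ : ∃ q, l = q + 1 := ⟨l - 1, by omega⟩
  have hzl : z ∈ koszulCyclesSpan ℳ (q + 1) := Submodule.subset_span ⟨hz2, q + 1, le_rfl, hz1⟩
  have hze : z ∈ koszulCyclesSpan ℳ e := by
    have := he (q + 1) hl.le
    simp only [OrderHom.coe_mk] at this
    rw [this]; exact hzl
  obtain ⟨b, hb, hbz⟩ := (hπ.exists_koszulD_eq_of_mem_span hze).2 q (by omega)
  have hbz' : koszulD σ K M b = z := by
    rw [hbz]; funext s; exact hπ.apply_of_mem _ _ (hz1 s)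
  refine ⟨koszulPart (i + 1) b, ?_, ?_⟩
  · rw [SetLike.mem_coe, show i + (q + 1) = i + 1 + q by ring]
    refine mem_koszulChains_add.2 ⟨fun s => ?_, fun s hs => by simp [koszulPart, hs]⟩
    unfold koszulPart
    split_ifs
    · exact hb s trivial
    · exact zero_mem _
  · rw [koszulD_koszulPart, hbz']
    funext s
    unfold koszulPart
    split_ifs with h
    · rfl
    · exact (hz3 s h).symm

/-- The Euler characteristic of the Koszul complex in internal degree `j`. -/
theorem IsGradedProjection.sum_gradedBetti [∀ q, FiniteDimensional K (ℳ q)]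
    (hπ : IsGradedProjection σ ℳ π) (j : ℕ) :
    ∑ i ∈ Finset.range (Fintype.card σ + 1), (-1 : ℤ) ^ i * gradedBetti σ ℳ i j =
      ∑ i ∈ Finset.range (Fintype.card σ + 1),
        (-1 : ℤ) ^ i * Module.finrank K (koszulChains σ ℳ i j) := by
  -- Partial sums telescope by rank-nullity up to the last space of boundaries, which vanishes when
  -- `n` is the number of variables.
  have key : ∀ n, ∑ i ∈ Finset.range (n + 1), (-1 : ℤ) ^ i * gradedBetti σ ℳ i j =
      ∑ i ∈ Finset.range (n + 1), (-1 : ℤ) ^ i * Module.finrank K (koszulChains σ ℳ i j)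
        - (-1) ^ n * Module.finrank K (koszulBoundaries σ ℳ n j) := by
    have hrank : ∀ n, Module.finrank K (koszulBoundaries σ ℳ n j) +
        Module.finrank K (koszulCycles σ ℳ (n + 1) j) =
        Module.finrank K (koszulChains σ ℳ (n + 1) j) := fun n => by
      have h := LinearMap.finrank_range_add_finrank_ker
        ((koszulD σ K M).domRestrict (koszulChains σ ℳ (n + 1) j))
      rw [LinearMap.range_domRestrict, LinearMap.ker_domRestrict] at h
      rw [← h]
      congr 1
      have e := (Submodule.equivSubtypeMap _ ((LinearMap.ker (koszulD σ K M)).comap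
        (koszulChains σ ℳ (n + 1) j).subtype)).finrank_eq
      rw [e, Submodule.map_comap_subtype]
      rfl
    intro n
    induction n with
    | zero =>
      have h := hπ.gradedBetti_add_finrank 0 j
      have : koszulCycles σ ℳ 0 j = koszulChains σ ℳ 0 j := by
        refine inf_eq_left.2 fun c hc => ?_
        rw [LinearMap.mem_ker]
        funext t
        refine Finset.sum_eq_zero fun v hv => ?_
        rw [apply_eq_zero_of_mem_koszulChains hc (by simp), smul_zero, smul_zero]
      rw [this] at h
      simp only [zero_add, Finset.sum_range_one, pow_zero, one_mul]
      rw [← h]; push_cast; ring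
    | succ n ih =>
      rw [Finset.sum_range_succ, ih, Finset.sum_range_succ _ (n + 1), ← hrank n,
        ← hπ.gradedBetti_add_finrank (n + 1) j]
      push_cast; ring
  rw [key, koszulBoundaries, koszulChains_eq_bot_of_card_lt (Nat.lt_succ_self _),
    Submodule.map_bot, finrank_bot]
  simp

theorem coeff_one_sub_X_pow (N i : ℕ) :
    PowerSeries.coeff i ((1 - PowerSeries.X : ℤ⟦X⟧) ^ N) = (-1) ^ i * N.choose i := by
  have : ((1 - PowerSeries.X : ℤ⟦X⟧) ^ N) =
      ((((1 + Polynomial.X) ^ N : ℤ[X]).comp (Polynomial.C (-1) * Polynomial.X) : ℤ[X]) : ℤ⟦X⟧) := by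
    simp [sub_eq_add_neg]
  rw [this, Polynomial.coeff_coe, Polynomial.comp_C_mul_X_coeff, Polynomial.coeff_one_add_X_pow,
    mul_comm]

/-- The Hilbert series of `M` times `(1 - t)^N` is the alternating sum of the Betti numbers. -/
theorem IsGradedProjection.coeff_hilbertSeries_mul [∀ q, FiniteDimensional K (ℳ q)]
    (hπ : IsGradedProjection σ ℳ π) (j : ℕ) :
    PowerSeries.coeff j (hilbertSeries ℳ * (1 - PowerSeries.X) ^ Fintype.card σ) =
      ∑ i ∈ Finset.range (Fintype.card σ + 1), (-1 : ℤ) ^ i * gradedBetti σ ℳ i j := by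
  rw [hπ.sum_gradedBetti, mul_comm, PowerSeries.coeff_mul,
    Finset.Nat.sum_antidiagonal_eq_sum_range_succ_mk]
  simp only [coeff_one_sub_X_pow, finrank_koszulChains, hilbertSeries, PowerSeries.coeff_mk]
  have h1 : ∀ i ∈ Finset.range j.succ,
      (-1 : ℤ) ^ i * (Fintype.card σ).choose i * Module.finrank K (ℳ (j - i)) =
      (-1) ^ i * (if i ≤ j then (Fintype.card σ).choose i * Module.finrank K (ℳ (j - i)) else 0 :
        ℕ) := fun i hi => by
    rw [if_pos (by simpa [Nat.lt_succ_iff] using hi)]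
    push_cast; ring
  -- Both sums are extended by zero to the range up to `max j N`: the binomial vanishes beyond `N`,
  -- and the chain dimension vanishes beyond `j`.
  rw [Finset.sum_congr rfl h1,
    Finset.sum_subset (Finset.range_mono (Nat.succ_le_succ (le_max_left j (Fintype.card σ)))),
    Finset.sum_subset (s₁ := Finset.range (Fintype.card σ + 1))
      (Finset.range_mono (Nat.succ_le_succ (le_max_right j (Fintype.card σ))))]
  · intro i _ hi
    rw [Nat.choose_eq_zero_of_lt (by simpa using hi)]
    simp
  · intro i _ hi
    rw [if_neg (by simpa [Nat.lt_succ_iff] using hi)]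
    simp

end Graded

/-! ### The grading of `S / I` and its filtration by degree. -/

section QuotientGrading

variable {σ K : Type*} [Fintype σ] [LinearOrder σ] [Field K] {I : Ideal (MvPolynomial σ K)}

theorem homogeneousComponent_X_mul (v : σ) (f : MvPolynomial σ K) (n : ℕ) :
    MvPolynomial.homogeneousComponent n (MvPolynomial.X v * f) =
      ∑ i ∈ Finset.range (f.totalDegree + 1),
        if n = i + 1 then MvPolynomial.X v * MvPolynomial.homogeneousComponent i f else 0 := by
  conv_lhs => rw [← MvPolynomial.sum_homogeneousComponent f, Finset.mul_sum, map_sum]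
  refine Finset.sum_congr rfl fun i _ => ?_
  have h : MvPolynomial.X v * MvPolynomial.homogeneousComponent i f ∈
      MvPolynomial.homogeneousSubmodule σ K (i + 1) := by
    rw [add_comm]
    exact MvPolynomial.homogeneousSubmodule_mul 1 i
      (Submodule.mul_mem_mul (MvPolynomial.isHomogeneous_X K v)
        (MvPolynomial.homogeneousComponent_mem i f))
  rw [MvPolynomial.homogeneousComponent_of_mem h]

theorem homogeneousComponent_succ_X_mul (v : σ) (f : MvPolynomial σ K) (n : ℕ) :
    MvPolynomial.homogeneousComponent (n + 1) (MvPolynomial.X v * f) =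
      MvPolynomial.X v * MvPolynomial.homogeneousComponent n f := by
  rw [homogeneousComponent_X_mul]
  simp only [Nat.add_right_cancel_iff, Finset.sum_ite_eq, Finset.mem_range]
  split_ifs with h
  · rfl
  · rw [MvPolynomial.homogeneousComponent_eq_zero _ _ (by omega), mul_zero]

theorem homogeneousComponent_zero_X_mul (v : σ) (f : MvPolynomial σ K) :
    MvPolynomial.homogeneousComponent 0 (MvPolynomial.X v * f) = 0 := by
  rw [homogeneousComponent_X_mul]
  simp

theorem sum_homogeneousComponent_of_totalDegree_lt (f : MvPolynomial σ K) {n : ℕ}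
    (h : f.totalDegree < n) :
    ∑ q ∈ Finset.range n, MvPolynomial.homogeneousComponent q f = f := by
  conv_rhs => rw [← MvPolynomial.sum_homogeneousComponent f]
  refine (Finset.sum_subset (Finset.range_mono h) fun q _ hq => ?_).symm
  exact MvPolynomial.homogeneousComponent_eq_zero _ _ (by simpa using hq)

/-- An ideal is closed under taking homogeneous components. -/
def IsComponentClosed (I : Ideal (MvPolynomial σ K)) : Prop :=
  ∀ f ∈ I, ∀ n, MvPolynomial.homogeneousComponent n f ∈ I

theorem isComponentClosed_span {s : Set (MvPolynomial σ K)}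
    (hs : ∀ f ∈ s, ∃ n, f ∈ MvPolynomial.homogeneousSubmodule σ K n) :
    IsComponentClosed (Ideal.span s) := by
  intro f hf
  induction hf using Submodule.span_induction with
  | mem f hf =>
    intro n
    obtain ⟨m, hm⟩ := hs f hf
    rw [MvPolynomial.homogeneousComponent_of_mem hm]
    split_ifs
    · exact Ideal.subset_span hf
    · exact zero_mem _
  | zero => intro n; rw [map_zero]; exact zero_mem _
  | add f g _ _ hf hg => intro n; rw [map_add]; exact add_mem (hf n) (hg n)
  | smul p f _ hf =>
    rw [smul_eq_mul]
    induction p using MvPolynomial.induction_on with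
    | C a =>
      intro n
      rw [MvPolynomial.homogeneousComponent_C_mul]
      exact Ideal.mul_mem_left _ _ (hf n)
    | add p q hp hq => intro n; rw [add_mul, map_add]; exact add_mem (hp n) (hq n)
    | mul_X p v hp =>
      rw [mul_comm p, mul_assoc]
      rintro (_ | n)
      · rw [homogeneousComponent_zero_X_mul]; exact zero_mem _
      · rw [homogeneousComponent_succ_X_mul]
        exact Ideal.mul_mem_left _ _ (hp n)

/-- The choice of representative does not matter; this is what makes `quotientProj` linear. -/
theorem IsComponentClosed.mk_out (hI : IsComponentClosed I) (q : ℕ) (f : MvPolynomial σ K) :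
    Ideal.Quotient.mk I (MvPolynomial.homogeneousComponent q (Ideal.Quotient.mk I f).out) =
      Ideal.Quotient.mk I (MvPolynomial.homogeneousComponent q f) := by
  rw [Ideal.Quotient.eq, ← map_sub]
  exact hI _ (Ideal.Quotient.eq.1 (Ideal.Quotient.mk_out _)) q

/-- The projection of `S / I` to its homogeneous component of degree `q`. -/
def quotientProj (hI : IsComponentClosed I) (q : ℕ) :
    (MvPolynomial σ K ⧸ I) →ₗ[K] (MvPolynomial σ K ⧸ I) where
  toFun a := Ideal.Quotient.mk I (MvPolynomial.homogeneousComponent q a.out)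
  map_add' a b := by
    obtain ⟨f, rfl⟩ := Ideal.Quotient.mk_surjective a
    obtain ⟨g, rfl⟩ := Ideal.Quotient.mk_surjective b
    rw [← map_add, hI.mk_out, hI.mk_out, hI.mk_out, map_add, map_add]
  map_smul' r a := by
    obtain ⟨f, rfl⟩ := Ideal.Quotient.mk_surjective a
    have h (g : MvPolynomial σ K) : r • Ideal.Quotient.mk I g = Ideal.Quotient.mk I (r • g) :=
      rfl
    rw [h, hI.mk_out, hI.mk_out, map_smul, RingHom.id_apply, h]

theorem quotientProj_mk (hI : IsComponentClosed I) (q : ℕ) (f : MvPolynomial σ K) :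
    quotientProj hI q (Ideal.Quotient.mk I f) =
      Ideal.Quotient.mk I (MvPolynomial.homogeneousComponent q f) :=
  hI.mk_out q f

theorem mem_quotientPiece {q : ℕ} {a : MvPolynomial σ K ⧸ I} :
    a ∈ quotientPiece I q ↔
      ∃ f ∈ MvPolynomial.homogeneousSubmodule σ K q, Ideal.Quotient.mk I f = a := Iff.rfl

theorem isGradedProjection_quotientProj (hI : IsComponentClosed I) :
    IsGradedProjection σ (quotientPiece I) (quotientProj hI) where
  mem q a := ⟨_, MvPolynomial.homogeneousComponent_mem q a.out, rfl⟩
  apply_of_mem q a ha := by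
    obtain ⟨f, hf, rfl⟩ := mem_quotientPiece.1 ha
    rw [quotientProj_mk, MvPolynomial.homogeneousComponent_of_mem hf, if_pos rfl]
  apply_of_ne q q' a ha hq := by
    obtain ⟨f, hf, rfl⟩ := mem_quotientPiece.1 ha
    rw [quotientProj_mk, MvPolynomial.homogeneousComponent_of_mem hf, if_neg hq, map_zero]
  sum_apply a := by
    obtain ⟨f, rfl⟩ := Ideal.Quotient.mk_surjective a
    refine ⟨f.totalDegree + 1, fun n hn => ?_⟩
    simp only [quotientProj_mk, ← map_sum]
    rw [sum_homogeneousComponent_of_totalDegree_lt f hn]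
  X_smul q v a := by
    obtain ⟨f, rfl⟩ := Ideal.Quotient.mk_surjective a
    have h (g : MvPolynomial σ K) : (MvPolynomial.X v : MvPolynomial σ K) •
      Ideal.Quotient.mk I g = Ideal.Quotient.mk I (MvPolynomial.X v * g) := rfl
    rw [h, quotientProj_mk, quotientProj_mk, homogeneousComponent_succ_X_mul, h]
  zero_X_smul v a := by
    obtain ⟨f, rfl⟩ := Ideal.Quotient.mk_surjective a
    have h (g : MvPolynomial σ K) : (MvPolynomial.X v : MvPolynomial σ K) •
      Ideal.Quotient.mk I g = Ideal.Quotient.mk I (MvPolynomial.X v * g) := rfl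
    rw [h, quotientProj_mk, homogeneousComponent_zero_X_mul, map_zero]

instance quotientPiece_finite (q : ℕ) : FiniteDimensional K (quotientPiece I q) := by
  rw [FiniteDimensional, Module.finite_def, Submodule.fg_top]
  exact (MvPolynomial.homogeneousSubmodule_fg σ K q).map _

variable (I) in
/-- The elements of `S / I` represented by polynomials of degree at most `k`. -/
def quotientFiltration (k : ℕ) : Submodule K (MvPolynomial σ K ⧸ I) :=
  (MvPolynomial.restrictTotalDegree σ K k).map (Ideal.Quotient.mkₐ K I).toLinearMap

theorem mem_quotientFiltration {k : ℕ} {a : MvPolynomial σ K ⧸ I} :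
    a ∈ quotientFiltration I k ↔ ∃ f, f.totalDegree ≤ k ∧ Ideal.Quotient.mk I f = a := by
  simp only [quotientFiltration, Submodule.mem_map, MvPolynomial.mem_restrictTotalDegree]
  rfl

instance quotientFiltration_finite (k : ℕ) : FiniteDimensional K (quotientFiltration I k) := by
  unfold quotientFiltration
  infer_instance

theorem quotientFiltration_mono : Monotone (quotientFiltration I) := fun k l h a ha => by
  obtain ⟨f, hf, rfl⟩ := mem_quotientFiltration.1 ha
  exact mem_quotientFiltration.2 ⟨f, hf.trans h, rfl⟩

theorem exists_mem_quotientFiltration (a : MvPolynomial σ K ⧸ I) :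
    ∃ k, a ∈ quotientFiltration I k := by
  obtain ⟨f, rfl⟩ := Ideal.Quotient.mk_surjective a
  exact ⟨_, mem_quotientFiltration.2 ⟨f, le_rfl, rfl⟩⟩

theorem mul_mem_quotientFiltration {k l : ℕ} {a b : MvPolynomial σ K ⧸ I}
    (ha : a ∈ quotientFiltration I k) (hb : b ∈ quotientFiltration I l) :
    a * b ∈ quotientFiltration I (k + l) := by
  obtain ⟨f, hf, rfl⟩ := mem_quotientFiltration.1 ha
  obtain ⟨g, hg, rfl⟩ := mem_quotientFiltration.1 hb
  exact mem_quotientFiltration.2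
    ⟨f * g, (MvPolynomial.totalDegree_mul f g).trans (add_le_add hf hg), map_mul _ _ _⟩

theorem pow_mem_quotientFiltration {k : ℕ} {a : MvPolynomial σ K ⧸ I}
    (ha : a ∈ quotientFiltration I k) (n : ℕ) : a ^ n ∈ quotientFiltration I (k * n) := by
  obtain ⟨f, hf, rfl⟩ := mem_quotientFiltration.1 ha
  refine mem_quotientFiltration.2 ⟨f ^ n, (MvPolynomial.totalDegree_pow f n).trans ?_, map_pow _ _ _⟩
  rw [mul_comm]
  exact Nat.mul_le_mul_right _ hf

/-- Noether normalization as used below need not respect the grading, so growth is measured on the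
filtration. This converts it back to the Hilbert function. -/
theorem finrank_quotientFiltration (hI : IsComponentClosed I) (k : ℕ) :
    Module.finrank K (quotientFiltration I k) =
      ∑ q ∈ Finset.range (k + 1), Module.finrank K (quotientPiece I q) := by
  have hπ := isGradedProjection_quotientProj hI
  let φ : quotientFiltration I k →ₗ[K] ∀ q : Fin (k + 1), quotientPiece I q :=
    LinearMap.pi fun q => ((quotientProj hI q).codRestrict _ (hπ.mem q)).comp
      (quotientFiltration I k).subtype
  have hφ (a : quotientFiltration I k) (q : Fin (k + 1)) :
      ((φ a q : quotientPiece I q) : MvPolynomial σ K ⧸ I) = quotientProj hI q a := rfl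
  have hbij : Function.Bijective φ := by
    constructor
    · rw [← LinearMap.ker_eq_bot, LinearMap.ker_eq_bot']
      rintro ⟨a, ha⟩ h0
      obtain ⟨f, hf, rfl⟩ := mem_quotientFiltration.1 ha
      refine Subtype.ext ?_
      change Ideal.Quotient.mk I f = 0
      rw [← sum_homogeneousComponent_of_totalDegree_lt f (Nat.lt_succ_of_le hf), map_sum]
      refine Finset.sum_eq_zero fun q hq => ?_
      rw [← quotientProj_mk hI]
      have := hφ ⟨_, ha⟩ ⟨q, Finset.mem_range.1 hq⟩
      rw [h0] at this
      exact this.symm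
    · intro g
      choose f hf hfg using fun q => mem_quotientPiece.1 (g q).2
      refine ⟨⟨Ideal.Quotient.mk I (∑ q, f q), mem_quotientFiltration.2 ⟨_, ?_, rfl⟩⟩, ?_⟩
      · refine MvPolynomial.totalDegree_finsetSum_le fun q _ => ?_
        exact (MvPolynomial.IsHomogeneous.totalDegree_le (hf q)).trans (Nat.lt_succ_iff.1 q.2)
      · funext q
        refine Subtype.ext ?_
        rw [hφ]
        change quotientProj hI q (Ideal.Quotient.mk I (∑ q, f q)) = _
        rw [map_sum, map_sum, Finset.sum_eq_single q]
        · rw [hfg]; exact hπ.apply_of_mem _ _ (g q).2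
        · intro b _ hb
          rw [hfg]
          exact hπ.apply_of_ne _ _ _ (g b).2 fun h => hb (Fin.ext h.symm)
        · simp
  rw [(LinearEquiv.ofBijective φ hbij).finrank_eq, Module.finrank_pi_fintype,
    Fin.sum_univ_eq_sum_range fun q => Module.finrank K (quotientPiece I q)]

end QuotientGrading

/-! ### Krull dimension under integral extensions. -/

section KrullDimension

/-- Incomparability gives one inequality; lying over for the bottom prime of a chain, followed by
going up, gives the other. -/
theorem ringKrullDim_eq_of_isIntegral {R A : Type*} [CommRing R] [CommRing A] (f : R →+* A)
    (hf : f.IsIntegral) (hinj : Function.Injective f) : ringKrullDim A = ringKrullDim R := by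
  algebraize [f]
  apply le_antisymm
  · refine Order.krullDim_le_of_strictMono (PrimeSpectrum.comap (algebraMap R A)) fun P Q h => ?_
    exact Ideal.IsIntegral.comap_lt_comap h
  · refine iSup_le fun l => ?_
    obtain ⟨P, hP, hPl⟩ := Ideal.exists_ideal_over_prime_of_isIntegral l.head.asIdeal (⊥ : Ideal A)
      (by rw [← RingHom.ker_eq_comap_bot, (RingHom.injective_iff_ker_eq_bot (algebraMap R A)).1 hinj]
          exact bot_le)
    obtain ⟨hPp, hPl⟩ := hPl
    have : P.LiesOver l.head.asIdeal := ⟨hPl.symm⟩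
    obtain ⟨L, hL, -⟩ := Ideal.exists_ltSeries_of_hasGoingUp l P
    rw [← hL]
    exact le_iSup (fun L : LTSeries (PrimeSpectrum A) => (L.length : WithBot ℕ∞)) L

end KrullDimension

/-! ### Comparing polynomial growth. -/

section Growth

theorem natDegree_le_of_eventually_le {P Q : ℝ[X]}
    (h : ∀ᶠ k : ℕ in Filter.atTop, |P.eval (k : ℝ)| ≤ |Q.eval (k : ℝ)|) :
    P.natDegree ≤ Q.natDegree := by
  by_contra! hlt
  have hP : P ≠ 0 := by rintro rfl; simp at hlt
  have ht := (Polynomial.div_tendsto_atTop_zero_of_degree_lt Q P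
    (Polynomial.degree_lt_degree hlt)).comp tendsto_natCast_atTop_atTop
  have h1 : ∀ᶠ k : ℕ in Filter.atTop, |Q.eval (k : ℝ) / P.eval (k : ℝ)| < 1 := by
    have := ht.eventually (Metric.ball_mem_nhds (0 : ℝ) one_pos)
    filter_upwards [this] with k hk
    rwa [dist_zero_right, Real.norm_eq_abs] at hk
  have h2 : ∀ᶠ k : ℕ in Filter.atTop, P.eval (k : ℝ) ≠ 0 := by
    have := Polynomial.eventually_atTop_not_isRoot P hP
    exact tendsto_natCast_atTop_atTop.eventually this
  obtain ⟨k, hk, hk1, hk2⟩ := (h.and (h1.and h2)).exists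
  rw [abs_div, div_lt_one (abs_pos.2 hk2)] at hk1
  exact absurd hk hk1.not_ge

theorem finrank_restrictDegree (K : Type*) [Field K] (s k : ℕ) :
    Module.finrank K (MvPolynomial.restrictDegree (Fin s) K k) = (k + 1) ^ s := by
  have e : {n : Fin s →₀ ℕ | ∀ i, n i ≤ k} ≃ (Fin s → Fin (k + 1)) :=
    { toFun := fun n i => ⟨n.1 i, Nat.lt_succ_of_le (n.2 i)⟩
      invFun := fun g => ⟨Finsupp.equivFunOnFinite.symm fun i => (g i : ℕ),
        fun i => Nat.lt_succ_iff.1 (g i).2⟩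
      left_inv := fun n => by ext; simp
      right_inv := fun g => by ext; simp }
  have b := MvPolynomial.basisRestrictSupport K {n : Fin s →₀ ℕ | ∀ i, n i ≤ k}
  have := Module.finrank_eq_nat_card_basis b
  rw [Nat.card_congr e] at this
  rw [MvPolynomial.restrictDegree, this]
  simp

end Growth

theorem exists_generators_of_finite {R A : Type*} [CommRing R] [CommRing A] (f : R →+* A)
    (hf : f.Finite) :
    ∃ (m : ℕ) (b : Fin m → A), ∀ a, ∃ c : Fin m → R, ∑ l, f (c l) * b l = a := by
  algebraize [f]
  obtain ⟨m, b, hb⟩ := Module.Finite.exists_fin (R := R) (M := A)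
  refine ⟨m, b, fun a => ?_⟩
  have ha : a ∈ Submodule.span R (Set.range b) := hb ▸ trivial
  exact (Submodule.mem_span_range_iff_exists_fun _).1 ha

/-! ### The pole order of the Hilbert series is the dimension. -/

section Dimension

variable {σ K : Type*} [Fintype σ] [LinearOrder σ] [Field K] {I : Ideal (MvPolynomial σ K)}

theorem prod_mem_quotientFiltration {ι : Type*} (t : Finset ι) (a : ι → MvPolynomial σ K ⧸ I)
    (k : ι → ℕ) (h : ∀ i ∈ t, a i ∈ quotientFiltration I (k i)) :
    ∏ i ∈ t, a i ∈ quotientFiltration I (∑ i ∈ t, k i) := by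
  classical
  induction t using Finset.induction_on with
  | empty => exact mem_quotientFiltration.2 ⟨1, by simp, by simp⟩
  | insert i t hi ih =>
    rw [Finset.prod_insert hi, Finset.sum_insert hi]
    exact mul_mem_quotientFiltration (h i (Finset.mem_insert_self i t))
      (ih fun j hj => h j (Finset.mem_insert_of_mem hj))

/-- If `K[z₁, …, zₛ]` embeds into `S / I`, then the Hilbert function of `S / I` grows at least like
that of a polynomial ring in `s` variables. -/
theorem exists_pow_le_finrank_quotientFiltration {s : ℕ}
    (g : MvPolynomial (Fin s) K →ₐ[K] MvPolynomial σ K ⧸ I) (hg : Function.Injective g) :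
    ∃ e, 0 < e ∧ ∀ k, (k + 1) ^ s ≤ Module.finrank K (quotientFiltration I (e * k)) := by
  choose d hd using fun i => exists_mem_quotientFiltration (g (MvPolynomial.X i))
  -- The extra `1` keeps the factor positive even if every `d i` is zero, so that `e * k` is
  -- unbounded.
  refine ⟨(∑ i, d i) + 1, Nat.succ_pos _, fun k => ?_⟩
  have hmem : ∀ f ∈ MvPolynomial.restrictDegree (Fin s) K k,
      g f ∈ quotientFiltration I (((∑ i, d i) + 1) * k) := by
    intro f hf
    rw [MvPolynomial.aeval_unique g, MvPolynomial.aeval_def, MvPolynomial.eval₂_eq']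
    refine Submodule.sum_mem _ fun n hn => ?_
    rw [← Algebra.smul_def]
    refine Submodule.smul_mem _ _ ?_
    refine quotientFiltration_mono ?_ (prod_mem_quotientFiltration _ _ (fun i => d i * n i)
      fun i _ => pow_mem_quotientFiltration (hd i) _)
    calc ∑ i, d i * n i ≤ ∑ i, d i * k := Finset.sum_le_sum fun i _ =>
          Nat.mul_le_mul_left _ ((MvPolynomial.mem_restrictDegree _ f k).1 hf n hn i)
      _ = (∑ i, d i) * k := by rw [Finset.sum_mul]
      _ ≤ _ := Nat.mul_le_mul_right _ (Nat.le_succ _)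
  rw [← finrank_restrictDegree K s k]
  refine LinearMap.finrank_le_finrank_of_injective (f := (g.toLinearMap.restrict hmem)) ?_
  intro x y hxy
  exact Subtype.ext (hg (congrArg Subtype.val hxy))

/-- If `S / I` is finite over the polynomial ring `K[z₁, …, zₛ]`, then the Hilbert function of
`S / I` grows at most like that of a polynomial ring in `s` variables. -/
theorem exists_finrank_quotientFiltration_le {s : ℕ}
    (g : MvPolynomial (Fin s) K →ₐ[K] MvPolynomial σ K ⧸ I) (hg : g.Finite) :
    ∃ m e, ∀ k, Module.finrank K (quotientFiltration I k) ≤ m * (e * (k + 1) + 1) ^ s := by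
  obtain ⟨m, b, hb⟩ : ∃ (m : ℕ) (b : Fin m → MvPolynomial σ K ⧸ I),
      ∀ a, ∃ c : Fin m → MvPolynomial (Fin s) K, ∑ l, g (c l) * b l = a := by
    exact exists_generators_of_finite g.toRingHom hg
  choose c hc using hb
  -- This bounds the degrees of the coefficients needed to write `1` and every product `X_v * b l`
  -- in the generators. Each multiplication by a variable thus costs at most `e`, and starting from
  -- `1` costs one more `e`, whence `e * (k + 1)`.
  let e : ℕ := (∑ l, (c 1 l).totalDegree) +
    ∑ v : σ, ∑ l, ∑ l', (c (Ideal.Quotient.mk I (MvPolynomial.X v) * b l) l').totalDegree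
  have he1 : ∀ l, (c 1 l).totalDegree ≤ e := fun l =>
    (Finset.single_le_sum (f := fun l => (c 1 l).totalDegree) (fun _ _ => Nat.zero_le _)
      (Finset.mem_univ l)).trans (Nat.le_add_right _ _)
  have heX : ∀ v l l',
      (c (Ideal.Quotient.mk I (MvPolynomial.X v) * b l) l').totalDegree ≤ e := fun v l l' => by
    refine le_trans ?_ (Nat.le_add_left _ _)
    refine le_trans ?_ (Finset.single_le_sum (fun _ _ => Nat.zero_le _) (Finset.mem_univ v))
    refine le_trans ?_ (Finset.single_le_sum (fun _ _ => Nat.zero_le _) (Finset.mem_univ l))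
    exact Finset.single_le_sum (f := fun l' =>
      (c (Ideal.Quotient.mk I (MvPolynomial.X v) * b l) l').totalDegree)
      (fun _ _ => Nat.zero_le _) (Finset.mem_univ l')
  let Φ (k : ℕ) : (Fin m → MvPolynomial.restrictTotalDegree (Fin s) K (e * (k + 1))) →ₗ[K]
      MvPolynomial σ K ⧸ I :=
    ∑ l, (LinearMap.mulRight K (b l)) ∘ₗ g.toLinearMap ∘ₗ Submodule.subtype _ ∘ₗ LinearMap.proj l
  have hΦ {k : ℕ} {a : MvPolynomial σ K ⧸ I} : a ∈ LinearMap.range (Φ k) ↔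
      ∃ h : Fin m → MvPolynomial (Fin s) K, (∀ l, (h l).totalDegree ≤ e * (k + 1)) ∧
        ∑ l, g (h l) * b l = a := by
    constructor
    · rintro ⟨h, rfl⟩
      refine ⟨fun l => h l, fun l => (MvPolynomial.mem_restrictTotalDegree _ _ _).1 (h l).2, ?_⟩
      simp [Φ]
    · rintro ⟨h, hh, rfl⟩
      refine ⟨fun l => ⟨h l, (MvPolynomial.mem_restrictTotalDegree _ _ _).2 (hh l)⟩, ?_⟩
      simp [Φ]
  have hmono {k l : ℕ} (hkl : k ≤ l) : LinearMap.range (Φ k) ≤ LinearMap.range (Φ l) := by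
    intro a ha
    obtain ⟨h, hh, rfl⟩ := hΦ.1 ha
    exact hΦ.2 ⟨h, fun i => (hh i).trans (Nat.mul_le_mul_left _ (by omega)), rfl⟩
  have hX {k : ℕ} (v : σ) {a : MvPolynomial σ K ⧸ I} (ha : a ∈ LinearMap.range (Φ k)) :
      Ideal.Quotient.mk I (MvPolynomial.X v) * a ∈ LinearMap.range (Φ (k + 1)) := by
    obtain ⟨h, hh, rfl⟩ := hΦ.1 ha
    refine hΦ.2 ⟨fun l' => ∑ l, h l * c (Ideal.Quotient.mk I (MvPolynomial.X v) * b l) l',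
      fun l' => MvPolynomial.totalDegree_finsetSum_le fun l _ => ?_, ?_⟩
    · refine (MvPolynomial.totalDegree_mul _ _).trans ?_
      rw [mul_add e (k + 1) 1, mul_one]
      exact add_le_add (hh l) (heX v l l')
    · simp only [map_sum, map_mul, Finset.sum_mul, Finset.mul_sum]
      rw [Finset.sum_comm]
      refine Finset.sum_congr rfl fun l _ => ?_
      rw [mul_left_comm, ← hc (Ideal.Quotient.mk I (MvPolynomial.X v) * b l), Finset.mul_sum, hc]
      exact Finset.sum_congr rfl fun l' _ => mul_assoc _ _ _
  have hpiece (q : ℕ) (f : MvPolynomial σ K)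
      (hf : f ∈ MvPolynomial.homogeneousSubmodule σ K q) :
      Ideal.Quotient.mk I f ∈ LinearMap.range (Φ q) := by
    rw [← MvPolynomial.homogeneousSubmodule_one_pow] at hf
    induction hf using Submodule.pow_induction_on_left' with
    | algebraMap r =>
      have : Ideal.Quotient.mk I (algebraMap K (MvPolynomial σ K) r) = r • 1 := by
        rw [← Algebra.algebraMap_eq_smul_one]; rfl
      rw [this]
      exact Submodule.smul_mem _ _ (hΦ.2 ⟨c 1, fun l => by simpa using he1 l, hc 1⟩)
    | add x y i _ _ hx hy => rw [map_add]; exact Submodule.add_mem _ hx hy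
    | mem_mul p hp i x _ hx =>
      rw [MvPolynomial.homogeneousSubmodule_one_eq_span_X] at hp
      induction hp using Submodule.span_induction with
      | mem p hp =>
        obtain ⟨v, rfl⟩ := hp
        rw [map_mul]
        exact hX v hx
      | zero => rw [zero_mul, map_zero]; exact Submodule.zero_mem _
      | add p q _ _ hp hq => simpa only [add_mul, map_add] using Submodule.add_mem _ hp hq
      | smul r p _ hp =>
        have : Ideal.Quotient.mk I (r • p * x) = r • Ideal.Quotient.mk I (p * x) := by
          rw [smul_mul_assoc]; rfl
        rw [this]
        exact Submodule.smul_mem _ _ hp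
  refine ⟨m, e, fun k => ?_⟩
  have hle : quotientFiltration I k ≤ LinearMap.range (Φ k) := by
    intro a ha
    obtain ⟨f, hf, rfl⟩ := mem_quotientFiltration.1 ha
    rw [← sum_homogeneousComponent_of_totalDegree_lt f (Nat.lt_succ_of_le hf), map_sum]
    refine Submodule.sum_mem _ fun q hq => hmono (Nat.lt_succ_iff.1 (Finset.mem_range.1 hq)) ?_
    exact hpiece q _ (MvPolynomial.homogeneousComponent_mem q f)
  calc Module.finrank K (quotientFiltration I k) ≤ Module.finrank K (LinearMap.range (Φ k)) :=
        Submodule.finrank_mono hle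
    _ ≤ _ := LinearMap.finrank_range_le _
    _ = m * Module.finrank K (MvPolynomial.restrictTotalDegree (Fin s) K (e * (k + 1))) := by
        rw [Module.finrank_pi_fintype]; simp
    _ ≤ m * (e * (k + 1) + 1) ^ s := by
        rw [← finrank_restrictDegree K s]
        exact Nat.mul_le_mul_left _ (Submodule.finrank_mono
          (MvPolynomial.restrictTotalDegree_le_restrictDegree _ _ _))

/-- The order of the pole at `1` of the Hilbert series of `S / I` is the dimension of `S / I`. -/
theorem supportDim_quotient_eq (hI : IsComponentClosed I) (hI1 : I ≠ ⊤) {Q : ℤ[X]} {N : ℕ}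
    (hQ : hilbertSeries (quotientPiece I) * (1 - PowerSeries.X) ^ N = (Q : ℤ⟦X⟧)) :
    Q.rootMultiplicity 1 ≤ N ∧
      Module.supportDim (MvPolynomial σ K) (MvPolynomial σ K ⧸ I) =
        (N - Q.rootMultiplicity 1 : ℕ) := by
  have : Nontrivial (MvPolynomial σ K ⧸ I) := Ideal.Quotient.nontrivial_iff.2 hI1
  obtain ⟨s, g, hginj, hgfin⟩ :=
    exists_finite_inj_algHom_of_fg K (MvPolynomial σ K ⧸ I)
  have hdim : Module.supportDim (MvPolynomial σ K) (MvPolynomial σ K ⧸ I) = s := by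
    rw [Module.supportDim_quotient_eq_ringKrullDim]
    rw [ringKrullDim_eq_of_isIntegral g.toRingHom (RingHom.Finite.to_isIntegral hgfin) hginj,
      MvPolynomial.ringKrullDim_of_isNoetherianRing, ringKrullDim_eq_zero_of_field]
    simp
  obtain ⟨e₁, he₁, hlow⟩ := exists_pow_le_finrank_quotientFiltration g hginj
  obtain ⟨m, e₂, hup⟩ := exists_finrank_quotientFiltration_le g hgfin
  -- The exponent is `N + 1` because cumulative sums of the Hilbert function divide its series by
  -- one more factor `1 - t`.
  let P : ℝ[X] := Polynomial.hilbertPoly (Q.map (Int.castRingHom ℝ)) (N + 1)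
  have hP : ∀ k, Q.natDegree < k →
      (Module.finrank K (quotientFiltration I k) : ℝ) = P.eval (k : ℝ) := by
    intro k hk
    have hk' : (Q.map (Int.castRingHom ℝ)).natDegree < k :=
      (Polynomial.natDegree_map_le).trans_lt hk
    rw [← Polynomial.coeff_mul_invOneSubPow_eq_hilbertPoly_eval (N + 1) hk',
      finrank_quotientFiltration hI]
    have h1 : ((Q.map (Int.castRingHom ℝ) : ℝ[X]) : ℝ⟦X⟧) =
        PowerSeries.map (Int.castRingHom ℝ) (hilbertSeries (quotientPiece I)) *
          (1 - PowerSeries.X) ^ N := by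
      rw [Polynomial.polynomial_map_coe, ← hQ]
      simp
    rw [h1, mul_assoc, add_comm N 1,
      PowerSeries.one_sub_pow_mul_invOneSubPow_val_add_eq_invOneSubPow_val,
      PowerSeries.invOneSubPow_val_eq_mk_sub_one_add_choose_of_pos _ _ one_pos,
      PowerSeries.coeff_mul, Finset.Nat.sum_antidiagonal_eq_sum_range_succ_mk]
    simp [hilbertSeries]
  have hP0 : P ≠ 0 := by
    intro h0
    have h1 := hlow (Q.natDegree + 1)
    have h2 := hP (e₁ * (Q.natDegree + 1)) (Nat.lt_of_succ_le (Nat.le_mul_of_pos_left _ he₁))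
    rw [h0, Polynomial.eval_zero, Nat.cast_eq_zero] at h2
    rw [h2] at h1
    exact absurd h1 (Nat.not_le.2 (by positivity))
  have hmult : (Q.map (Int.castRingHom ℝ)).rootMultiplicity 1 = Q.rootMultiplicity 1 := by
    rw [Polynomial.eq_rootMultiplicity_map (f := Int.castRingHom ℝ) Int.cast_injective, map_one]
  have hN : Q.rootMultiplicity 1 ≤ N := by
    by_contra! h
    exact hP0 (Polynomial.hilbertPoly_eq_zero_of_le_rootMultiplicity_one (by rw [hmult]; exact h))
  have hdeg : P.natDegree = N - Q.rootMultiplicity 1 := by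
    rw [Polynomial.natDegree_hilbertPoly_of_ne_zero hP0, hmult]
    omega
  refine ⟨hN, ?_⟩
  rw [hdim, ← hdeg]
  congr 1
  -- The growth bounds `(k + 1)^s ≤ P(e₁ k)` and `P(k) ≤ m (e₂ (k + 1) + 1)^s`, for large `k`, force
  -- `deg P = s`.
  apply le_antisymm
  · have := natDegree_le_of_eventually_le (P := (Polynomial.X + 1) ^ s)
      (Q := P.comp (Polynomial.C (e₁ : ℝ) * Polynomial.X)) ?_
    · rw [Polynomial.natDegree_comp, Polynomial.natDegree_C_mul_X _ (by positivity)] at this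
      have h1 : ((Polynomial.X + 1 : ℝ[X]) ^ s).natDegree = s := by
        rw [Polynomial.natDegree_pow, ← Polynomial.C_1, Polynomial.natDegree_X_add_C, mul_one]
      rwa [h1, mul_one] at this
    · filter_upwards [Filter.eventually_gt_atTop Q.natDegree] with k hk
      have h2 := hP (e₁ * k) (hk.trans_le (Nat.le_mul_of_pos_left _ he₁))
      have h3 : (((k + 1) ^ s : ℕ) : ℝ) ≤ Module.finrank K (quotientFiltration I (e₁ * k)) := by
        exact_mod_cast hlow k
      rw [h2] at h3
      push_cast at h3
      refine le_trans ?_ (h3.trans ?_) |>.trans (le_abs_self _)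
      · rw [abs_of_nonneg] <;> simp; positivity
      · simp
  · have := natDegree_le_of_eventually_le (P := P) (Q := Polynomial.C (m : ℝ) *
      (Polynomial.C (e₂ : ℝ) * (Polynomial.X + 1) + 1) ^ s) ?_
    · refine this.trans ?_
      compute_degree
    · filter_upwards [Filter.eventually_gt_atTop Q.natDegree] with k hk
      rw [← hP k hk, Nat.abs_cast]
      refine le_trans ?_ (le_abs_self _)
      simp only [Polynomial.eval_mul, Polynomial.eval_C, Polynomial.eval_pow, Polynomial.eval_add,
        Polynomial.eval_X, Polynomial.eval_one]
      exact_mod_cast hup k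

end Dimension

/-! ### The corner of the Betti table and the degree of the numerator. -/

section UniqueExtremal

variable {σ K M : Type*} [Fintype σ] [LinearOrder σ] [Field K] [AddCommGroup M]
  [Module (MvPolynomial σ K) M] [Module K M] [IsScalarTower K (MvPolynomial σ K) M]
  {ℳ : ℕ → Submodule K M} {π : ℕ → M →ₗ[K] M}

/-- A unique extremal Betti number sits in the bottom right corner of the Betti table. -/
theorem IsGradedProjection.exists_corner [IsNoetherian (MvPolynomial σ K) M]
    [∀ q, FiniteDimensional K (ℳ q)] (hπ : IsGradedProjection σ ℳ π)
    (h : HasUniqueExtremalBetti σ ℳ) :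
    ∃ p r, gradedBetti σ ℳ p (p + r) ≠ 0 ∧
      ∀ k l, gradedBetti σ ℳ k (k + l) ≠ 0 → k ≤ p ∧ l ≤ r := by
  obtain ⟨⟨p, r⟩, hpr, huniq⟩ := h
  refine ⟨p, r, hpr.1, fun k l hkl => ?_⟩
  obtain ⟨e, he⟩ := hπ.exists_gradedBetti_eq_zero
  let B : Set (ℕ × ℕ) := {a | gradedBetti σ ℳ a.1 (a.1 + a.2) ≠ 0}
  have hfin : B.Finite := by
    refine (Set.finite_Iic ((Fintype.card σ, e) : ℕ × ℕ)).subset fun a ha => ⟨?_, ?_⟩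
    · by_contra! h1
      exact ha (gradedBetti_eq_zero_of_card_lt h1)
    · by_contra! h1
      exact ha (he _ _ h1)
  -- A maximal position above `(k, l)` in the finite support is extremal, so it is `(p, r)` by
  -- uniqueness.
  obtain ⟨⟨k', l'⟩, hle, hmax⟩ := hfin.exists_le_maximal (show (k, l) ∈ B from hkl)
  have hext : IsExtremalBetti σ ℳ k' l' := by
    refine ⟨hmax.prop, fun a b ha hb hab => ?_⟩
    by_contra h1
    exact hab (hmax.eq_of_ge (y := (a, b)) h1 ⟨ha, hb⟩)
  obtain ⟨rfl, rfl⟩ := Prod.mk.inj (huniq (k', l') hext)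
  exact hle

/-- The numerator of the Hilbert series over `(1 - t)^N`, where `N` is the number of variables. -/
theorem IsGradedProjection.exists_numerator [∀ q, FiniteDimensional K (ℳ q)]
    (hπ : IsGradedProjection σ ℳ π) {p r : ℕ} (hpr : gradedBetti σ ℳ p (p + r) ≠ 0)
    (hmax : ∀ k l, gradedBetti σ ℳ k (k + l) ≠ 0 → k ≤ p ∧ l ≤ r) :
    ∃ Q : ℤ[X], hilbertSeries ℳ * (1 - PowerSeries.X) ^ Fintype.card σ = (Q : ℤ⟦X⟧) ∧
      Q ≠ 0 ∧ Q.natDegree = p + r := by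
  have hzero : ∀ i j, gradedBetti σ ℳ i j ≠ 0 → i ≤ p ∧ j ≤ i + r := by
    intro i j hij
    have h : i ≤ j := by
      by_contra! h
      exact hij (gradedBetti_eq_zero_of_lt h)
    obtain ⟨l, rfl⟩ := Nat.exists_eq_add_of_le h
    have := hmax i l hij
    omega
  have hcoeff := hπ.coeff_hilbertSeries_mul
  set H := hilbertSeries ℳ * (1 - PowerSeries.X) ^ Fintype.card σ with hH
  -- A nonzero `β_{i,p+r}` needs both `i ≤ p` and `p + r ≤ i + r`, so only `i = p` contributes.
  have htop : PowerSeries.coeff (p + r) H ≠ 0 := by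
    rw [hcoeff, Finset.sum_eq_single p]
    · exact mul_ne_zero (pow_ne_zero _ (by norm_num)) (by exact_mod_cast hpr)
    · intro i _ hi
      have : gradedBetti σ ℳ i (p + r) = 0 := by
        by_contra h
        have := hzero _ _ h
        omega
      rw [this, Nat.cast_zero, mul_zero]
    · intro h
      exact absurd (gradedBetti_eq_zero_of_card_lt (by simpa using h)) hpr
  have hlarge : ∀ j, p + r < j → PowerSeries.coeff j H = 0 := by
    intro j hj
    rw [hcoeff]
    refine Finset.sum_eq_zero fun i _ => ?_
    have : gradedBetti σ ℳ i j = 0 := by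
      by_contra h
      have := hzero _ _ h
      omega
    rw [this, Nat.cast_zero, mul_zero]
  have hQ : ∀ j, (PowerSeries.trunc (p + r + 1) H).coeff j = PowerSeries.coeff j H := by
    intro j
    rw [PowerSeries.coeff_trunc]
    split_ifs with h
    · rfl
    · exact (hlarge j (by omega)).symm
  have hQtop : (PowerSeries.trunc (p + r + 1) H).coeff (p + r) ≠ 0 := by rwa [hQ]
  refine ⟨PowerSeries.trunc (p + r + 1) H, ?_, ?_, ?_⟩
  · ext j
    rw [Polynomial.coeff_coe, hQ]
  · intro h
    rw [h, Polynomial.coeff_zero] at hQtop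
    exact hQtop rfl
  · refine Polynomial.natDegree_eq_of_le_of_coeff_ne_zero ?_ hQtop
    exact Polynomial.natDegree_le_iff_coeff_eq_zero.2 fun j hj => by rw [hQ, hlarge j hj]

end UniqueExtremal

/-! ### The inequality for standard graded algebras. -/

section Quotient

variable {σ K : Type*} [Fintype σ] [LinearOrder σ] [Field K] {I : Ideal (MvPolynomial σ K)}

theorem span_X_smul_top_ne_top (hI : I ≤ Ideal.span (Set.range MvPolynomial.X)) :
    Ideal.span (Set.range (MvPolynomial.X : σ → MvPolynomial σ K)) •
      (⊤ : Submodule (MvPolynomial σ K) (MvPolynomial σ K ⧸ I)) ≠ ⊤ := by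
  intro h
  have hle : Ideal.span (Set.range (MvPolynomial.X : σ → MvPolynomial σ K)) •
      (⊤ : Submodule (MvPolynomial σ K) (MvPolynomial σ K ⧸ I)) ≤
      Submodule.map (Submodule.mkQ I) (Ideal.span (Set.range MvPolynomial.X)) := by
    refine Submodule.smul_le.2 fun f hf a _ => ?_
    obtain ⟨g, rfl⟩ := Submodule.mkQ_surjective _ a
    exact ⟨f * g, Ideal.mul_mem_right _ _ hf, rfl⟩
  rw [h] at hle
  obtain ⟨f, hf, hf1⟩ := hle (x := Submodule.mkQ I 1) trivial
  have h1 : (1 : MvPolynomial σ K) ∈ Ideal.span (Set.range MvPolynomial.X) := by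
    have h2 : f - 1 ∈ I := (Submodule.Quotient.eq I).1 hf1
    have := sub_mem hf (hI h2)
    rwa [sub_sub_cancel] at this
  have h3 : Ideal.span (Set.range (MvPolynomial.X : σ → MvPolynomial σ K)) ≤
      RingHom.ker (MvPolynomial.constantCoeff (R := K) (σ := σ)) := by
    refine Ideal.span_le.2 ?_
    rintro _ ⟨v, rfl⟩
    exact MvPolynomial.constantCoeff_X K v
  have := h3 h1
  rw [RingHom.mem_ker, map_one] at this
  exact one_ne_zero this

theorem hPolynomial_eq {h : ℤ[X]} (hh : IsHPolynomial σ (quotientPiece I) h) :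
    hPolynomial σ (quotientPiece I) = h := by
  have H : ∃ h, IsHPolynomial σ (quotientPiece I) h := ⟨h, hh⟩
  rw [hPolynomial, dif_pos H]
  exact H.choose_spec.unique σ hh

/-- If the standard graded algebra `S / I` has a unique extremal Betti number, then its regularity
is at most the degree of its `h`-polynomial. -/
theorem regularity_le_natDegree_hPolynomial (hI : IsComponentClosed I)
    (hIX : I ≤ Ideal.span (Set.range MvPolynomial.X))
    (hβ : HasUniqueExtremalBetti σ (quotientPiece I)) :
    regularity σ (quotientPiece I) ≤ ((hPolynomial σ (quotientPiece I)).natDegree : ℕ∞) := by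
  have hπ := isGradedProjection_quotientProj hI
  obtain ⟨p, r, hpr, hmax⟩ := hπ.exists_corner hβ
  obtain ⟨Q, hQ, hQ0, hQdeg⟩ := hπ.exists_numerator hpr hmax
  have htop := span_X_smul_top_ne_top hIX
  have hI1 : I ≠ ⊤ := by
    rintro rfl
    exact htop (Subsingleton.elim _ _)
  obtain ⟨hc, hdim⟩ := supportDim_quotient_eq hI hI1 hQ
  set c := Q.rootMultiplicity 1 with hcdef
  have hpN : p ≤ Fintype.card σ := by
    by_contra! h
    exact hpr (gradedBetti_eq_zero_of_card_lt h)
  -- Columns beyond `p` vanish, so the depth bound reads `N - p ≤ dim = N - c`.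
  have hcp : c ≤ p := by
    have hdepth := le_supportDim_of_koszulExactAt (σ := σ) (K := K) (Fintype.card σ - p)
      (M := MvPolynomial σ K ⧸ I) p (by omega)
      (fun i hi => hπ.koszulExactAt fun q => by
        by_contra h
        exact absurd (hmax i q h).1 hi.not_ge) htop
    rw [hdim] at hdepth
    have : Fintype.card σ - p ≤ Fintype.card σ - c := by exact_mod_cast hdepth
    omega
  obtain ⟨q, hq, hq1⟩ := Polynomial.exists_eq_pow_rootMultiplicity_mul_and_not_dvd Q hQ0 1
  rw [← hcdef, Polynomial.C_1] at hq
  -- The sign converts the factor `(X - 1)^c` into `(1 - X)^c`.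
  let h : ℤ[X] := (-1) ^ c * q
  have hQh : Q = (1 - Polynomial.X) ^ c * h := by
    rw [hq, ← mul_assoc, ← mul_pow]
    congr 2
    ring
  have hh : IsHPolynomial σ (quotientPiece I) h := by
    refine ⟨?_, Fintype.card σ - c, hdim, ?_⟩
    · rw [Polynomial.dvd_iff_isRoot] at hq1
      simpa [h] using hq1
    · have hne : ((1 : ℤ⟦X⟧) - PowerSeries.X) ^ c ≠ 0 := by
        refine pow_ne_zero _ fun h0 => ?_
        have := congrArg (PowerSeries.constantCoeff (R := ℤ)) h0
        simp at this
      refine mul_right_cancel₀ hne ?_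
      rw [mul_assoc, ← pow_add, Nat.sub_add_cancel hc, hQ, hQh]
      simp [mul_comm]
  have hh0 : h ≠ 0 := by
    rintro h0
    rw [h0, mul_zero] at hQh
    exact hQ0 hQh
  have hdegh : c + h.natDegree = p + r := by
    rw [← hQdeg, hQh, Polynomial.natDegree_mul (by
      intro h0
      rw [h0, zero_mul] at hQh
      exact hQ0 hQh) hh0, Polynomial.natDegree_pow,
      show (1 - Polynomial.X : ℤ[X]) = -(Polynomial.X - Polynomial.C 1) by simp,
      Polynomial.natDegree_neg, Polynomial.natDegree_X_sub_C, mul_one]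
  rw [hPolynomial_eq hh]
  refine iSup_le fun i => iSup_le fun l => iSup_le fun hil => ?_
  have := (hmax i l hil).2
  exact_mod_cast (by omega : l ≤ h.natDegree)

end Quotient

/-! ### Application to binomial edge ideals. -/

section EdgeIdeal

variable {K : Type*} [Field K] {n : ℕ} (G : SimpleGraph (Fin n))

theorem isComponentClosed_binomialEdgeIdeal : IsComponentClosed (binomialEdgeIdeal K G) := by
  refine isComponentClosed_span ?_
  rintro _ ⟨i, j, -, -, rfl⟩
  exact ⟨2, Submodule.sub_mem _
    ((MvPolynomial.isHomogeneous_X K _).mul (MvPolynomial.isHomogeneous_X K _))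
    ((MvPolynomial.isHomogeneous_X K _).mul (MvPolynomial.isHomogeneous_X K _))⟩

theorem binomialEdgeIdeal_le_span_X :
    binomialEdgeIdeal K G ≤ Ideal.span (Set.range MvPolynomial.X) := by
  refine Ideal.span_le.2 ?_
  rintro _ ⟨i, j, -, -, rfl⟩
  exact sub_mem (Ideal.mul_mem_right _ _ (Ideal.subset_span ⟨_, rfl⟩))
    (Ideal.mul_mem_right _ _ (Ideal.subset_span ⟨_, rfl⟩))

end EdgeIdeal

end BinomialEdge

end

theorem mainTheorem7 {K : Type*} [Field K] {n : ℕ} (G : SimpleGraph (Fin n))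
    (hG : G.Connected)
    (hβ : BinomialEdge.HasUniqueExtremalBetti (BinomialEdge.Vars n)
      (BinomialEdge.quotientPiece (BinomialEdge.binomialEdgeIdeal K G))) :
    BinomialEdge.regularity (BinomialEdge.Vars n)
        (BinomialEdge.quotientPiece (BinomialEdge.binomialEdgeIdeal K G)) ≤
      ((BinomialEdge.hPolynomial (BinomialEdge.Vars n)
        (BinomialEdge.quotientPiece (BinomialEdge.binomialEdgeIdeal K G))).natDegree : ℕ∞) :=
  BinomialEdge.regularity_le_natDegree_hPolynomial
    (BinomialEdge.isComponentClosed_binomialEdgeIdeal G)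
    (BinomialEdge.binomialEdgeIdeal_le_span_X G) hβ
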